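/- Fix a countably infinite set $\mathbb A$ of names and let $\mathrm{Perm}\,\mathbb A$ be the group of finite permutations of $\mathbb A$ (bijections moving only finitely many names); for $S\subseteq\mathbb A$ let $\mathrm{Perm}_S\,\mathbb A$ be the subgroup of permutations fixing every $a\in S$. Let $X$ be a set with a $\mathrm{Perm}\,\mathbb A$-action. A set $S\subseteq\mathbb A$ supports $x\in X$ if $\pi\cdot x=x$ for all $\pi\in\mathrm{Perm}_S\,\mathbb A$. The set $X$ is nominal if every element has a finite support, and then $\operatorname{supp}x$ denotes the least finite support of $x$. It is orbit-finite if it has finitely many orbits, and strong if for all $x$ and $\pi$ one has $\pi\cdot x=x$ iff $\pi$ fixes every name in $\operatorname{supp}x$. A nominal monoid is a monoid in nominal sets (equivariant multiplication and unit); its morphisms are the equivariant monoid homomorphisms. **Nominal Stone spaces.** A nominal topology on a nominal set $X$ is an equivariant set of finitely supported subsets of $X$ (the open sets) closed under finitely supported unions and finite intersections; in the discrete topology all finitely supported subsets are open. A nominal Stone space is a nominal topological space $X$ such that (i) every finitely supported open cover $\mathcal C$ contains finitely many sets $U_1,\dots,U_n$ with $X=\bigcup_i\bigcup\{\pi\cdot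 U_i\mid\pi\in\mathrm{Perm}\,\mathbb A\}$; (ii) for every finite $S\subseteq\mathbb A$, any two points in different $\mathrm{Perm}_S\,\mathbb A$-orbits have disjoint $S$-supported open neighbourhoods; (iii) $X$ has a basis of representable sets, i.e. of sets $f^{-1}[A]$ with $f\colon X\to Y$ continuous and equivariant, $Y$ orbit-finite discrete, and $A\subseteq Y$ finitely supported. Let $\mathrm{Mon}(\mathrm{nStone})$ be the category of nominal Stone spaces with a nominal monoid structure whose multiplication is continuous, and continuous equivariant monoid morphisms. Orbit-finite nominal monoids, with the discrete topology, belong to it. **Pro-orbit-finite words.** Let $\Sigma$ be an orbit-finite nominal set and $\Sigma^*$ the free monoid on $\Sigma$ with the letterwise action. A support bound is a map $s\colon\Sigma^*\to\mathcal P\mathbb A$ for which there is $k\in\mathbb N$ with $|s(w)|\le k$ for all $w$. A morphism $h\colon\Sigma^*\to K$ of nominal monoids is $s$-bounded if $\operatorname{supp}h(w)\subseteq s(w)$ for all $w$. The monoid $\widehat{\Sigma^*_s}$ of $s$-bounded pro-orbit-finite words is the limit of all $s$-bounded surjective morphisms $\Sigma^*\twoheadrightarrow K$ with $K$ orbit-finite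 (a codirected diagram): its elements are the finitely supported compatible families, its monoid structure is componentwise, and its topology is the initial one with respect to the projections into the discrete spaces $K$. It is an object of $\mathrm{Mon}(\mathrm{nStone})$. **MSR morphisms.** A surjective equivariant morphism $e\colon M\twoheadrightarrow N$ of nominal monoids is multiplicatively support-reflecting (MSR) if there is an equivariant submonoid $M'\subseteq M$ such that $e[M']=N$ and $\operatorname{supp}e(x)=\operatorname{supp}x$ for all $x\in M'$. **Proposition.** Let $e\colon M\twoheadrightarrow N$ be a surjective equivariant morphism between orbit-finite nominal monoids. Then $e$ is MSR if and only if, for every strong orbit-finite nominal set $\Sigma$ and every support bound $s$ on $\Sigma^*$, the monoid $\widehat{\Sigma^*_s}$ is projective with respect to $e$ in $\mathrm{Mon}(\mathrm{nStone})$, where $M$ and $N$ are regarded as discrete spaces: every morphism $f\colon\widehat{\Sigma^*_s}\to N$ of $\mathrm{Mon}(\mathrm{nStone})$ is of the form $f=e\circ g$ for some morphism $g\colon\widehat{\Sigma^*_s}\to M$ of $\mathrm{Mon}(\mathrm{nStone})$. -/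

import Mathlib

universe u

namespace NomMon

open scoped Pointwise
open MulAction (Supports)

/-! ## Finite permutations and nominal sets -/

/-- The finite permutations of the set `𝔸` of names: bijections moving only finitely many names. -/
def finPerm (𝔸 : Type u) : Subgroup (Equiv.Perm 𝔸) where
  carrier := {π | {a | π a ≠ a}.Finite}
  one_mem' := by simp
  mul_mem' := by
    intro π σ hπ hσ
    refine (Set.Finite.union hπ hσ).subset ?_
    intro a ha
    by_contra h
    simp only [Set.mem_union, Set.mem_ofPred_eq, not_or, not_not] at h
    exact ha (by simp [h.1, h.2])
  inv_mem' := by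
    intro π hπ
    refine Set.Finite.subset hπ ?_
    intro a ha h
    exact ha (by rw [Equiv.Perm.inv_eq_iff_eq]; exact h.symm)

/-- The group of finite permutations. -/
abbrev FinPerm (𝔸 : Type u) : Type u := finPerm 𝔸

section Basic

variable (𝔸 : Type u) {X Y : Type u} [MulAction (FinPerm 𝔸) X] [MulAction (FinPerm 𝔸) Y]

/-- `x` is finitely supported: some finite set of names supports `x`. (Applied to subsets of
`X`, with the pointwise action, it says that the subset belongs to the nominal powerset.) -/
def FinSupp (x : X) : Prop := ∃ S : Set 𝔸, S.Finite ∧ Supports (FinPerm 𝔸) S x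

/-- The intersection of all finite supports of `x`. For infinite `𝔸` and finitely supported `x`
this is the least finite support of `x`. -/
def supp (x : X) : Set 𝔸 := {a | ∀ S : Set 𝔸, S.Finite → Supports (FinPerm 𝔸) S x → a ∈ S}

/-- Nominal sets: every element has a finite support. -/
class Nominal (X : Type u) [MulAction (FinPerm 𝔸) X] : Prop where
  finSupp : ∀ x : X, FinSupp 𝔸 x

/-- There are only finitely many orbits. -/
class OrbitFinite (X : Type u) [MulAction (FinPerm 𝔸) X] : Prop where
  finite : Finite (MulAction.orbitRel.Quotient (FinPerm 𝔸) X)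

/-- Strong nominal sets: a permutation fixes `x` iff it fixes every name in the least support
of `x`. -/
def IsStrong (X : Type u) [MulAction (FinPerm 𝔸) X] : Prop :=
  ∀ (x : X) (π : FinPerm 𝔸), π • x = x ↔ ∀ a ∈ supp 𝔸 x, π • a = a

variable {𝔸}

/-! Auxiliary facts on supports -/

theorem supports_fix {S : Set 𝔸} {x : X} (h : Supports (FinPerm 𝔸) S x) {π : FinPerm 𝔸}
    (hπ : ∀ a ∈ S, π • a = a) : π • x = x := h π (fun _ ha => hπ _ ha)

theorem supports_map (f : X →[FinPerm 𝔸] Y) {S : Set 𝔸} {x : X}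
    (h : Supports (FinPerm 𝔸) S x) : Supports (FinPerm 𝔸) S (f x) := by
  intro π hπ
  rw [← map_smul, h π hπ]

theorem supports_smul {S : Set 𝔸} {x : X} (h : Supports (FinPerm 𝔸) S x) (σ : FinPerm 𝔸) :
    Supports (FinPerm 𝔸) (σ • S) (σ • x) := by
  intro π hπ
  have : (σ⁻¹ * π * σ) • x = x := by
    apply supports_fix h
    intro a ha
    have := hπ (Set.smul_mem_smul_set ha)
    rw [mul_smul, mul_smul, this, inv_smul_smul]
  rw [mul_smul, mul_smul, inv_smul_eq_iff] at this
  exact this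

theorem supports_set {S : Set 𝔸} {U : Set X}
    (h : ∀ π : FinPerm 𝔸, (∀ a ∈ S, π • a = a) → ∀ x ∈ U, π • x ∈ U) :
    Supports (FinPerm 𝔸) S U := by
  intro π hπ
  ext x
  constructor
  · rintro ⟨y, hy, rfl⟩
    exact h π (fun a ha => hπ ha) y hy
  · intro hx
    rw [Set.mem_smul_set_iff_inv_smul_mem]
    refine h π⁻¹ (fun a ha => ?_) x hx
    rw [inv_smul_eq_iff]
    exact (hπ ha).symm

theorem mem_of_supports {S : Set 𝔸} {U : Set X} (h : Supports (FinPerm 𝔸) S U)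
    {π : FinPerm 𝔸} (hπ : ∀ a ∈ S, π • a = a) {x : X} (hx : x ∈ U) : π • x ∈ U := by
  have := supports_fix h hπ
  rw [← this]
  exact Set.smul_mem_smul_set hx

theorem smul_preimage (f : X →[FinPerm 𝔸] Y) (π : FinPerm 𝔸) (U : Set Y) :
    π • (f ⁻¹' U) = f ⁻¹' (π • U) := by
  ext x
  simp only [Set.mem_smul_set_iff_inv_smul_mem, Set.mem_preimage, map_smul]

theorem supports_preimage (f : X →[FinPerm 𝔸] Y) {S : Set 𝔸} {U : Set Y}
    (h : Supports (FinPerm 𝔸) S U) : Supports (FinPerm 𝔸) S (f ⁻¹' U) := by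
  intro π hπ
  rw [smul_preimage, h π hπ]

/-- Names outside `S` can be moved away from a finite set `B`, fixing `S`. -/
theorem exists_avoid [Infinite 𝔸] (S B A : Set 𝔸) (hS : S.Finite) (hB : B.Finite)
    (hA : A.Finite) (hAS : ∀ a ∈ A, a ∉ S) :
    ∃ σ : FinPerm 𝔸, (∀ a ∈ S, σ • a = a) ∧ ∀ a ∈ A, σ • a ∉ B := by
  classical
  induction A, hA using Set.Finite.induction_on with
  | empty => exact ⟨1, by simp, by simp⟩
  | @insert a A ha hA ih =>
    obtain ⟨σ, h1, h2⟩ := ih (fun b hb => hAS b (Set.mem_insert_of_mem _ hb))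
    obtain ⟨c, hc⟩ := ((hB.union hS).union ((hA.image (fun x => σ • x)))).exists_notMem
    simp only [Set.mem_union, not_or] at hc
    have hsw : Equiv.swap (σ • a) c ∈ finPerm 𝔸 := by
      refine (Set.toFinite {σ • a, c}).subset ?_
      intro x hx
      by_contra h
      simp only [Set.mem_insert_iff, Set.mem_singleton_iff, not_or] at h
      exact hx (Equiv.swap_apply_of_ne_of_ne h.1 h.2)
    have hact : ∀ x, (⟨_, hsw⟩ * σ : FinPerm 𝔸) • x = Equiv.swap (σ • a) c (σ • x) :=
      fun x => rfl
    refine ⟨⟨_, hsw⟩ * σ, ?_, ?_⟩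
    · intro s hs
      rw [hact, h1 s hs]
      apply Equiv.swap_apply_of_ne_of_ne
      · intro h
        have : σ • s = σ • a := by rw [h1 s hs, h]
        have := smul_left_cancel σ this
        exact hAS a (Set.mem_insert _ _) (this ▸ hs)
      · rintro rfl
        exact hc.1.2 hs
    · rintro b (rfl | hb)
      · rw [hact, Equiv.swap_apply_left]
        exact hc.1.1
      · rw [hact, Equiv.swap_apply_of_ne_of_ne]
        · exact h2 b hb
        · intro h
          exact ha (smul_left_cancel σ h ▸ hb)
        · intro h
          exact hc.2 ⟨b, hb, h⟩

theorem supports_inter [Infinite 𝔸] {S T : Set 𝔸} (hS : S.Finite) (hT : T.Finite) {x : X}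
    (h1 : Supports (FinPerm 𝔸) S x) (h2 : Supports (FinPerm 𝔸) T x) :
    Supports (FinPerm 𝔸) (S ∩ T) x := by
  intro π hπ
  obtain ⟨σ, hσ, hσ'⟩ := exists_avoid S {a | π • a ≠ a} (T \ S) hS π.2 hT.sdiff
    (fun a ha => ha.2)
  have hx : σ • x = x := supports_fix h1 hσ
  have := supports_smul h2 σ
  rw [hx] at this
  apply supports_fix this
  rintro _ ⟨a, ha, rfl⟩
  by_cases haS : a ∈ S
  · simp only [hσ a haS]
    exact hπ ⟨haS, ha⟩
  · have := hσ' a ⟨ha, haS⟩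
    simpa using this

theorem supp_subset {S : Set 𝔸} (hS : S.Finite) {x : X} (h : Supports (FinPerm 𝔸) S x) :
    supp 𝔸 x ⊆ S := fun _ ha => ha S hS h

theorem supp_finite [Nominal 𝔸 X] (x : X) : (supp 𝔸 x).Finite := by
  obtain ⟨S, hS, h⟩ := Nominal.finSupp (𝔸 := 𝔸) x
  exact hS.subset (supp_subset hS h)

/-- The set `supp 𝔸 x` is a support, hence the least finite one. -/
theorem supports_supp [Infinite 𝔸] [Nominal 𝔸 X] (x : X) :
    Supports (FinPerm 𝔸) (supp 𝔸 x) x := by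
  classical
  obtain ⟨S, hS, h⟩ := Nominal.finSupp (𝔸 := 𝔸) x
  have hex : ∃ n, ∃ T : Set 𝔸, T.Finite ∧ Supports (FinPerm 𝔸) T x ∧ T.ncard = n :=
    ⟨_, S, hS, h, rfl⟩
  obtain ⟨T, hT, hTx, hn⟩ := Nat.find_spec hex
  have : supp 𝔸 x = T := by
    apply (supp_subset hT hTx).antisymm
    intro a ha R hR hRx
    by_contra haR
    have hlt : (T ∩ R).ncard < T.ncard :=
      Set.ncard_lt_ncard ⟨Set.inter_subset_left, fun h => haR (h ha).2⟩ hT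
    exact Nat.find_min hex (hn ▸ hlt)
      ⟨T ∩ R, hT.subset Set.inter_subset_left, supports_inter hT hR hTx hRx, rfl⟩
  rw [this]
  exact hTx

theorem supp_map_subset [Infinite 𝔸] [Nominal 𝔸 X] (f : X →[FinPerm 𝔸] Y) (x : X) :
    supp 𝔸 (f x) ⊆ supp 𝔸 x :=
  supp_subset (supp_finite x) (supports_map f (supports_supp x))

theorem supp_smul_subset [Infinite 𝔸] [Nominal 𝔸 X] (π : FinPerm 𝔸) (x : X) :
    supp 𝔸 (π • x) ⊆ π • supp 𝔸 x :=
  supp_subset ((supp_finite x).smul_set) (supports_smul (supports_supp x) π)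

/-- Every injective map on a finite set of names extends to a finite permutation that moves only
names in the domain and the image. -/
theorem exists_extension (A : Set 𝔸) (hA : A.Finite) (f : 𝔸 → 𝔸) (hf : Set.InjOn f A) :
    ∃ σ : FinPerm 𝔸, (∀ a ∈ A, σ • a = f a) ∧ ∀ a, a ∉ A → a ∉ f '' A → σ • a = a := by
  classical
  let W : Set 𝔸 := A ∪ f '' A
  have hW : W.Finite := hA.union (hA.image f)
  have : Finite W := hW
  let e : {x : W // (x : 𝔸) ∈ A} ≃ {x : W // (x : 𝔸) ∈ f '' A} :=
    Equiv.ofBijective (fun x => ⟨⟨f x.1, Or.inr ⟨_, x.2, rfl⟩⟩, ⟨_, x.2, rfl⟩⟩) (by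
      constructor
      · intro x y h
        have h' : f x.1 = f y.1 := congrArg (fun z => (z.1 : 𝔸)) h
        exact Subtype.ext (Subtype.ext (hf x.2 y.2 h'))
      · rintro ⟨⟨y, hy⟩, a, ha, hay⟩
        exact ⟨⟨⟨a, Or.inl ha⟩, ha⟩, Subtype.ext (Subtype.ext hay)⟩)
  let g : Equiv.Perm 𝔸 := Equiv.Perm.ofSubtype (p := (· ∈ W)) e.extendSubtype
  have hg : ∀ a, a ∉ W → g a = a := fun a ha => Equiv.Perm.ofSubtype_apply_of_not_mem _ ha
  refine ⟨⟨g, hW.subset fun a ha => ?_⟩, ?_, ?_⟩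
  · by_contra h
    exact ha (hg a h)
  · intro a ha
    change g a = f a
    have haW : a ∈ W := Or.inl ha
    rw [show g a = _ from Equiv.Perm.ofSubtype_apply_of_mem _ haW]
    rw [Equiv.extendSubtype_apply_of_mem e ⟨a, haW⟩ ha]
    rfl
  · intro a h1 h2
    exact hg a (by rintro (h | h); exacts [h1 h, h2 h])

theorem exists_smul_supports [Infinite 𝔸] [Nominal 𝔸 X] (x : X) (T : Set 𝔸) (hT : T.Finite)
    (h : (supp 𝔸 x).ncard ≤ T.ncard) :
    ∃ π : FinPerm 𝔸, Supports (FinPerm 𝔸) T (π • x) := by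
  classical
  obtain ⟨f, hf, hinj⟩ : ∃ f : 𝔸 → 𝔸, f '' supp 𝔸 x ⊆ T ∧ Set.InjOn f (supp 𝔸 x) := by
    obtain ⟨T', hT', hc⟩ := Set.exists_subset_card_eq h
    have hfin := supp_finite (𝔸 := 𝔸) x
    have : Finite (supp 𝔸 x) := hfin
    have : Finite T' := hT.subset hT'
    obtain ⟨e⟩ : Nonempty (supp 𝔸 x ≃ T') :=
      (Finite.card_eq).1 (by simpa [Nat.card_coe_set_eq] using hc.symm)
    refine ⟨fun a => if ha : a ∈ supp 𝔸 x then e ⟨a, ha⟩ else a, ?_, ?_⟩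
    · rintro _ ⟨a, ha, rfl⟩
      simp only [ha, dif_pos]
      exact hT' (e ⟨a, ha⟩).2
    · intro a ha b hb hab
      simp only [ha, hb, dif_pos] at hab
      simpa using e.injective (Subtype.ext hab)
  obtain ⟨σ, h1, -⟩ := exists_extension _ (supp_finite x) f hinj
  refine ⟨σ, (supports_smul (supports_supp x) σ).mono ?_⟩
  rintro _ ⟨a, ha, rfl⟩
  exact hf ⟨a, ha, (h1 a ha).symm⟩

theorem finite_supports [Infinite 𝔸] [Nominal 𝔸 X] [OrbitFinite 𝔸 X] (T : Set 𝔸)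
    (hT : T.Finite) : {x : X | Supports (FinPerm 𝔸) T x}.Finite := by
  classical
  have : Finite (MulAction.orbitRel.Quotient (FinPerm 𝔸) X) := OrbitFinite.finite
  have key : ∀ z : X, {x : X | x ∈ MulAction.orbit (FinPerm 𝔸) z ∧
      Supports (FinPerm 𝔸) T x}.Finite := by
    intro z
    have : Finite (supp 𝔸 z) := supp_finite z
    have : Finite T := hT
    -- an element `π • z` is determined by the restriction of `π` to the support of `z`
    let r : FinPerm 𝔸 → (supp 𝔸 z → Option T) := fun π a =>
      if h : π • (a : 𝔸) ∈ T then some ⟨π • (a : 𝔸), h⟩ else none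
    let F : (supp 𝔸 z → Option T) → X := fun ρ =>
      if h : ∃ π : FinPerm 𝔸, Supports (FinPerm 𝔸) T (π • z) ∧ r π = ρ then h.choose • z else z
    refine (Set.finite_range F).subset ?_
    rintro _ ⟨⟨π, rfl⟩, hx⟩
    have hx : Supports (FinPerm 𝔸) T (π • z) := hx
    refine ⟨r π, ?_⟩
    have hex : ∃ π' : FinPerm 𝔸, Supports (FinPerm 𝔸) T (π' • z) ∧ r π' = r π := ⟨π, hx, rfl⟩
    simp only [F, dif_pos hex]
    have hsup : ∀ π : FinPerm 𝔸, Supports (FinPerm 𝔸) T (π • z) →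
        ∀ a ∈ supp 𝔸 z, π • a ∈ T := by
      intro π hπ a ha
      have := supports_smul hπ π⁻¹
      rw [inv_smul_smul] at this
      have := supp_subset (hT.smul_set) this ha
      rwa [Set.mem_smul_set_iff_inv_smul_mem, inv_inv] at this
    have h2 := hex.choose_spec
    set σ := hex.choose
    have : (π⁻¹ * σ) • z = z := by
      apply supports_fix (supports_supp z)
      intro a ha
      rw [mul_smul, inv_smul_eq_iff]
      have := congrFun h2.2 ⟨a, ha⟩
      simpa only [r, dif_pos (hsup σ h2.1 a ha), dif_pos (hsup π hx a ha), Option.some.injEq,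
        Subtype.mk.injEq] using this
    rwa [mul_smul, inv_smul_eq_iff] at this
  refine (Set.finite_iUnion (fun q : MulAction.orbitRel.Quotient (FinPerm 𝔸) X =>
    key q.out)).subset ?_
  intro x hx
  refine Set.mem_iUnion.2 ⟨Quotient.mk'' x, ?_, hx⟩
  rw [← MulAction.orbitRel_apply]
  exact (MulAction.orbitRel (FinPerm 𝔸) X).symm
    (Quotient.mk_out (s := MulAction.orbitRel (FinPerm 𝔸) X) x)

theorem orbitFinite_of_finite (T : Set 𝔸) (h1 : {x : X | Supports (FinPerm 𝔸) T x}.Finite)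
    (h2 : ∀ x : X, ∃ π : FinPerm 𝔸, Supports (FinPerm 𝔸) T (π • x)) : OrbitFinite 𝔸 X := by
  constructor
  have : Finite {x : X | Supports (FinPerm 𝔸) T x} := h1
  refine Finite.of_surjective
    (fun x : {x : X | Supports (FinPerm 𝔸) T x} =>
      (Quotient.mk'' x.1 : MulAction.orbitRel.Quotient (FinPerm 𝔸) X)) ?_
  intro q
  induction q using Quotient.inductionOn' with
  | h x =>
    obtain ⟨π, hπ⟩ := h2 x
    exact ⟨⟨π • x, hπ⟩, Quotient.sound' ⟨π, rfl⟩⟩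

end Basic

/-! ## Nominal topological spaces -/

/-- A nominal topology on `X`: an equivariant set of finitely supported subsets of `X` closed
under finitely supported unions and finite intersections. -/
structure NomTop (𝔸 : Type u) (X : Type u) [MulAction (FinPerm 𝔸) X] where
  opens : Set (Set X)
  finSupp : ∀ U ∈ opens, FinSupp 𝔸 U
  smul_mem : ∀ (π : FinPerm 𝔸), ∀ U ∈ opens, π • U ∈ opens
  sUnion_mem : ∀ 𝒰 ⊆ opens, FinSupp 𝔸 𝒰 → ⋃₀ 𝒰 ∈ opens
  univ_mem : Set.univ ∈ opens
  inter_mem : ∀ U ∈ opens, ∀ V ∈ opens, U ∩ V ∈ opens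

section Topology

variable {𝔸 : Type u} {X Y : Type u} [MulAction (FinPerm 𝔸) X] [MulAction (FinPerm 𝔸) Y]

theorem smul_sUnion (π : FinPerm 𝔸) (𝒰 : Set (Set X)) : π • ⋃₀ 𝒰 = ⋃₀ (π • 𝒰) := by
  ext x
  simp only [Set.mem_smul_set_iff_inv_smul_mem, Set.mem_sUnion]
  constructor
  · rintro ⟨U, hU, hx⟩
    exact ⟨π • U, by rwa [inv_smul_smul], by rwa [Set.mem_smul_set_iff_inv_smul_mem]⟩
  · rintro ⟨U, hU, hx⟩
    exact ⟨π⁻¹ • U, hU, by rwa [Set.mem_smul_set_iff_inv_smul_mem, inv_inv, smul_inv_smul]⟩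

theorem FinSupp.smul {x : X} (h : FinSupp 𝔸 x) (π : FinPerm 𝔸) : FinSupp 𝔸 (π • x) := by
  obtain ⟨S, hS, h⟩ := h
  exact ⟨π • S, hS.smul_set, supports_smul h π⟩

theorem FinSupp.inter {U V : Set X} (hU : FinSupp 𝔸 U) (hV : FinSupp 𝔸 V) :
    FinSupp 𝔸 (U ∩ V) := by
  obtain ⟨S, hS, hSU⟩ := hU
  obtain ⟨T, hT, hTV⟩ := hV
  exact ⟨S ∪ T, hS.union hT, supports_set fun π hπ x hx =>
    ⟨mem_of_supports hSU (fun a ha => hπ a (Or.inl ha)) hx.1,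
      mem_of_supports hTV (fun a ha => hπ a (Or.inr ha)) hx.2⟩⟩

theorem FinSupp.sUnion {𝒰 : Set (Set X)} (h : FinSupp 𝔸 𝒰) : FinSupp 𝔸 (⋃₀ 𝒰) := by
  obtain ⟨S, hS, h⟩ := h
  exact ⟨S, hS, fun π hπ => by rw [smul_sUnion, h π hπ]⟩

theorem FinSupp.univ : FinSupp 𝔸 (Set.univ : Set X) :=
  ⟨∅, Set.finite_empty, supports_set fun _ _ _ _ => trivial⟩

theorem FinSupp.preimage (f : X →[FinPerm 𝔸] Y) {U : Set Y} (h : FinSupp 𝔸 U) :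
    FinSupp 𝔸 (f ⁻¹' U) := by
  obtain ⟨S, hS, h⟩ := h
  exact ⟨S, hS, supports_preimage f h⟩

theorem FinSupp.singleton {x : X} (h : FinSupp 𝔸 x) : FinSupp 𝔸 ({x} : Set X) := by
  obtain ⟨S, hS, h⟩ := h
  refine ⟨S, hS, supports_set ?_⟩
  rintro π hπ _ rfl
  exact supports_fix h hπ

namespace NomTop

/-- The discrete topology: every finitely supported subset is open. -/
def discrete (𝔸 : Type u) (X : Type u) [MulAction (FinPerm 𝔸) X] : NomTop 𝔸 X where
  opens := {U | FinSupp 𝔸 U}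
  finSupp _ h := h
  smul_mem π _ h := FinSupp.smul h π
  sUnion_mem _ _ h := h.sUnion
  univ_mem := FinSupp.univ
  inter_mem _ hU _ hV := FinSupp.inter hU hV

/-- The sets obtained from members of `ℬ` by finite intersections and finitely supported
unions. -/
inductive GenOpen (𝔸 : Type u) {X : Type u} [MulAction (FinPerm 𝔸) X] (ℬ : Set (Set X)) :
    Set X → Prop
  | basic (U : Set X) : U ∈ ℬ → GenOpen 𝔸 ℬ U
  | univ : GenOpen 𝔸 ℬ Set.univ
  | inter (U V : Set X) : GenOpen 𝔸 ℬ U → GenOpen 𝔸 ℬ V → GenOpen 𝔸 ℬ (U ∩ V)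
  | sUnion (𝒰 : Set (Set X)) : FinSupp 𝔸 𝒰 → (∀ U ∈ 𝒰, GenOpen 𝔸 ℬ U) → GenOpen 𝔸 ℬ (⋃₀ 𝒰)

/-- The coarsest nominal topology whose open sets include the members of `ℬ`, an equivariant
set of finitely supported subsets. -/
def generate (ℬ : Set (Set X)) (hfs : ∀ U ∈ ℬ, FinSupp 𝔸 U)
    (hsm : ∀ (π : FinPerm 𝔸), ∀ U ∈ ℬ, π • U ∈ ℬ) : NomTop 𝔸 X where
  opens := {U | GenOpen 𝔸 ℬ U}
  finSupp U h := by
    induction h with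
    | basic U hU => exact hfs U hU
    | univ => exact FinSupp.univ
    | inter U V _ _ ihU ihV => exact ihU.inter ihV
    | sUnion 𝒰 h𝒰 _ _ => exact h𝒰.sUnion
  smul_mem π U h := by
    induction h with
    | basic U hU => exact GenOpen.basic _ (hsm π U hU)
    | univ => rw [Set.smul_set_univ]; exact GenOpen.univ
    | inter U V _ _ ihU ihV => rw [Set.smul_set_inter]; exact GenOpen.inter _ _ ihU ihV
    | sUnion 𝒰 h𝒰 _ ih =>
      rw [smul_sUnion]
      refine GenOpen.sUnion _ (h𝒰.smul π) ?_
      rintro _ ⟨U, hU, rfl⟩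
      exact ih U hU
  sUnion_mem 𝒰 h h𝒰 := GenOpen.sUnion 𝒰 h𝒰 h
  univ_mem := GenOpen.univ
  inter_mem U hU V hV := GenOpen.inter U V hU hV

/-- The initial topology with respect to a family of equivariant maps. -/
def initial {ι : Type u} {Z : ι → Type u} [∀ i, MulAction (FinPerm 𝔸) (Z i)]
    (f : ∀ i, X →[FinPerm 𝔸] Z i) (τ : ∀ i, NomTop 𝔸 (Z i)) : NomTop 𝔸 X :=
  generate {V | ∃ i, ∃ U ∈ (τ i).opens, V = f i ⁻¹' U}
    (by rintro _ ⟨i, U, hU, rfl⟩; exact ((τ i).finSupp U hU).preimage (f i))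
    (by
      rintro π _ ⟨i, U, hU, rfl⟩
      exact ⟨i, π • U, (τ i).smul_mem π U hU, smul_preimage (f i) π U⟩)

/-- The first projection, as an equivariant map. -/
def fstHom (𝔸 X Y : Type u) [MulAction (FinPerm 𝔸) X] [MulAction (FinPerm 𝔸) Y] :
    X × Y →[FinPerm 𝔸] X := ⟨Prod.fst, fun _ _ => rfl⟩

/-- The second projection, as an equivariant map. -/
def sndHom (𝔸 X Y : Type u) [MulAction (FinPerm 𝔸) X] [MulAction (FinPerm 𝔸) Y] :
    X × Y →[FinPerm 𝔸] Y := ⟨Prod.snd, fun _ _ => rfl⟩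

/-- The product topology: the initial topology with respect to the two projections. -/
def prod (τ : NomTop 𝔸 X) (σ : NomTop 𝔸 Y) : NomTop 𝔸 (X × Y) :=
  generate {W | (∃ U ∈ τ.opens, W = fstHom 𝔸 X Y ⁻¹' U) ∨ ∃ V ∈ σ.opens, W = sndHom 𝔸 X Y ⁻¹' V}
    (by
      rintro _ (⟨U, hU, rfl⟩ | ⟨V, hV, rfl⟩)
      · exact (τ.finSupp U hU).preimage _
      · exact (σ.finSupp V hV).preimage _)
    (by
      rintro π _ (⟨U, hU, rfl⟩ | ⟨V, hV, rfl⟩)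
      · exact Or.inl ⟨π • U, τ.smul_mem π U hU, smul_preimage _ π U⟩
      · exact Or.inr ⟨π • V, σ.smul_mem π V hV, smul_preimage _ π V⟩)

/-- Continuity: preimages of open sets are open. -/
def Continuous (τ : NomTop 𝔸 X) (σ : NomTop 𝔸 Y) (f : X → Y) : Prop :=
  ∀ U ∈ σ.opens, f ⁻¹' U ∈ τ.opens

/-- Nominal compactness: every finitely supported open cover has an orbit-finite subcover. -/
def IsCompact (τ : NomTop 𝔸 X) : Prop :=
  ∀ 𝒞 ⊆ τ.opens, FinSupp 𝔸 𝒞 → ⋃₀ 𝒞 = Set.univ →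
    ∃ ℱ ⊆ 𝒞, ℱ.Finite ∧ ⋃ U ∈ ℱ, ⋃₀ MulAction.orbit (FinPerm 𝔸) U = Set.univ

/-- The nominal Hausdorff property: for finite `S`, points in different `S`-orbits have disjoint
`S`-supported open neighbourhoods. -/
def IsHausdorff (τ : NomTop 𝔸 X) : Prop :=
  ∀ S : Set 𝔸, S.Finite → ∀ x y : X,
    (¬ ∃ π : FinPerm 𝔸, (∀ a ∈ S, π • a = a) ∧ π • x = y) →
    ∃ U ∈ τ.opens, ∃ V ∈ τ.opens, Supports (FinPerm 𝔸) S U ∧ Supports (FinPerm 𝔸) S V ∧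
      x ∈ U ∧ y ∈ V ∧ Disjoint U V

/-- Representable subsets: preimages of finitely supported subsets under continuous equivariant
maps into orbit-finite discrete spaces. -/
def Representable (τ : NomTop 𝔸 X) (R : Set X) : Prop :=
  ∃ (Z : Type u) (_ : MulAction (FinPerm 𝔸) Z) (_ : Nominal 𝔸 Z) (_ : OrbitFinite 𝔸 Z)
    (f : X →[FinPerm 𝔸] Z), Continuous τ (discrete 𝔸 Z) f ∧
      ∃ A : Set Z, FinSupp 𝔸 A ∧ R = f ⁻¹' A

/-- A basis: an equivariant set of open sets such that every open set (in particular, every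
finite intersection of members) is a finitely supported union of members. -/
def IsBasis (τ : NomTop 𝔸 X) (ℬ : Set (Set X)) : Prop :=
  ℬ ⊆ τ.opens ∧ (∀ (π : FinPerm 𝔸), ∀ U ∈ ℬ, π • U ∈ ℬ) ∧
    ∀ U ∈ τ.opens, ∃ 𝒰 ⊆ ℬ, FinSupp 𝔸 𝒰 ∧ U = ⋃₀ 𝒰

/-- Nominal Stone spaces: compact, Hausdorff, and with a basis of representable sets. -/
structure IsStone (τ : NomTop 𝔸 X) : Prop where
  compact : τ.IsCompact
  hausdorff : τ.IsHausdorff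
  basis : ∃ ℬ : Set (Set X), τ.IsBasis ℬ ∧ ∀ R ∈ ℬ, τ.Representable R

theorem exists_finSupp_sUnion {ℰ : Set (Set X)} (hsm : ∀ (π : FinPerm 𝔸), ∀ U ∈ ℰ, π • U ∈ ℰ)
    {W : Set X} (hW : FinSupp 𝔸 W) (h : ∀ x ∈ W, ∃ E ∈ ℰ, x ∈ E ∧ E ⊆ W) :
    ∃ 𝒰 ⊆ ℰ, FinSupp 𝔸 𝒰 ∧ W = ⋃₀ 𝒰 := by
  obtain ⟨S, hS, hSW⟩ := hW
  refine ⟨{E | E ∈ ℰ ∧ E ⊆ W}, fun E hE => hE.1, ⟨S, hS, supports_set ?_⟩, ?_⟩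
  · rintro π hπ E ⟨hE, hEW⟩
    refine ⟨hsm π E hE, ?_⟩
    rintro _ ⟨x, hx, rfl⟩
    exact mem_of_supports hSW hπ (hEW hx)
  · ext x
    constructor
    · intro hx
      obtain ⟨E, hE, hxE, hEW⟩ := h x hx
      exact ⟨E, ⟨hE, hEW⟩, hxE⟩
    · rintro ⟨E, ⟨-, hEW⟩, hx⟩
      exact hEW hx

theorem mem_opens_of_nhds (τ : NomTop 𝔸 X) {ℰ : Set (Set X)} (hop : ℰ ⊆ τ.opens)
    (hsm : ∀ (π : FinPerm 𝔸), ∀ U ∈ ℰ, π • U ∈ ℰ)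
    {W : Set X} (hW : FinSupp 𝔸 W) (h : ∀ x ∈ W, ∃ E ∈ ℰ, x ∈ E ∧ E ⊆ W) : W ∈ τ.opens := by
  obtain ⟨𝒰, h𝒰, hfs, rfl⟩ := exists_finSupp_sUnion hsm hW h
  exact τ.sUnion_mem 𝒰 (h𝒰.trans hop) hfs

theorem prod_mem (τ : NomTop 𝔸 X) (σ : NomTop 𝔸 Y) {U : Set X} {V : Set Y}
    (hU : U ∈ τ.opens) (hV : V ∈ σ.opens) : U ×ˢ V ∈ (τ.prod σ).opens :=
  GenOpen.inter (𝔸 := 𝔸) _ _ (GenOpen.basic _ (Or.inl ⟨U, hU, rfl⟩))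
    (GenOpen.basic _ (Or.inr ⟨V, hV, rfl⟩))

theorem smul_prod (π : FinPerm 𝔸) (U : Set X) (V : Set Y) :
    π • (U ×ˢ V) = (π • U) ×ˢ (π • V) := by
  ext ⟨x, y⟩
  simp only [Set.mem_smul_set_iff_inv_smul_mem, Set.mem_prod, Prod.smul_mk]

/-- Orbit-finite discrete spaces are nominal Stone spaces. -/
theorem isStone_discrete [Nominal 𝔸 X] [OrbitFinite 𝔸 X] : (discrete 𝔸 X).IsStone where
  compact := by
    intro 𝒞 _ _ hcov
    have : Finite (MulAction.orbitRel.Quotient (FinPerm 𝔸) X) := OrbitFinite.finite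
    have hx : ∀ x : X, ∃ U ∈ 𝒞, x ∈ U := fun x => by
      have : x ∈ ⋃₀ 𝒞 := hcov ▸ trivial
      exact this
    choose U hU hxU using hx
    refine ⟨Set.range fun q : MulAction.orbitRel.Quotient (FinPerm 𝔸) X => U q.out, ?_,
      Set.finite_range _, ?_⟩
    · rintro _ ⟨q, rfl⟩
      exact hU _
    · rw [Set.eq_univ_iff_forall]
      intro x
      obtain ⟨π, hπ⟩ : x ∈ MulAction.orbit (FinPerm 𝔸)
          (Quotient.mk'' x : MulAction.orbitRel.Quotient (FinPerm 𝔸) X).out := by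
        rw [← MulAction.orbitRel_apply]
        exact (MulAction.orbitRel (FinPerm 𝔸) X).symm
          (Quotient.mk_out (s := MulAction.orbitRel (FinPerm 𝔸) X) x)
      refine Set.mem_iUnion₂.2 ⟨_, ⟨Quotient.mk'' x, rfl⟩, _, ⟨π, rfl⟩, ?_⟩
      have h2 := Set.smul_mem_smul_set (a := π)
        (hxU (Quotient.mk'' x : MulAction.orbitRel.Quotient (FinPerm 𝔸) X).out)
      dsimp only at hπ
      rw [hπ] at h2
      exact h2
  hausdorff := by
    intro S hS x y hxy
    have key : ∀ z : X, Supports (FinPerm 𝔸) S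
        {w : X | ∃ π : FinPerm 𝔸, (∀ a ∈ S, π • a = a) ∧ π • z = w} := by
      intro z
      refine supports_set ?_
      rintro σ hσ _ ⟨π, hπ, rfl⟩
      exact ⟨σ * π, fun a ha => by rw [mul_smul, hπ a ha, hσ a ha], mul_smul _ _ _⟩
    refine ⟨_, ⟨S, hS, key x⟩, _, ⟨S, hS, key y⟩, key x, key y, ⟨1, by simp, by simp⟩,
      ⟨1, by simp, by simp⟩, ?_⟩
    rw [Set.disjoint_left]
    rintro z ⟨π, hπ, rfl⟩ ⟨σ, hσ, h⟩
    refine hxy ⟨σ⁻¹ * π, fun a ha => ?_, by rw [mul_smul, ← h, inv_smul_smul]⟩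
    rw [mul_smul, hπ a ha, inv_smul_eq_iff, hσ a ha]
  basis := by
    refine ⟨(discrete 𝔸 X).opens, ⟨subset_rfl, (discrete 𝔸 X).smul_mem, ?_⟩, ?_⟩
    · intro U hU
      refine exists_finSupp_sUnion (discrete 𝔸 X).smul_mem hU fun x hx => ⟨U, hU, hx, subset_rfl⟩
    · intro R hR
      exact ⟨X, inferInstance, inferInstance, inferInstance, MulActionHom.id _,
        fun U hU => hU, R, hR, rfl⟩

theorem continuous_mul_discrete [Nominal 𝔸 X] {f : X × X → X}
    (hf : ∀ (π : FinPerm 𝔸) p, f (π • p) = π • f p) :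
    Continuous ((discrete 𝔸 X).prod (discrete 𝔸 X)) (discrete 𝔸 X) f := by
  intro U hU
  refine mem_opens_of_nhds _ (ℰ := {E | ∃ a b : X, E = {a} ×ˢ {b}}) ?_ ?_
    (FinSupp.preimage (⟨f, hf⟩ : X × X →[FinPerm 𝔸] X) hU) ?_
  · rintro _ ⟨a, b, rfl⟩
    exact prod_mem _ _ (FinSupp.singleton (Nominal.finSupp a))
      (FinSupp.singleton (Nominal.finSupp b))
  · rintro π _ ⟨a, b, rfl⟩
    exact ⟨π • a, π • b, by rw [smul_prod, Set.smul_set_singleton, Set.smul_set_singleton]⟩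
  · rintro ⟨a, b⟩ h
    refine ⟨_, ⟨a, b, rfl⟩, by simp, ?_⟩
    rintro ⟨a', b'⟩ h'
    simp only [Set.singleton_prod_singleton, Set.mem_singleton_iff] at h'
    rw [h']
    exact h

end NomTop

end Topology

/-! ## Pro-orbit-finite words

Nominal monoids are monoids `M` with `[MulDistribMulAction (FinPerm 𝔸) M] [Nominal 𝔸 M]`: both
the multiplication and the unit are equivariant. Their morphisms are the maps
`M →*[FinPerm 𝔸] N`. -/

section Words

variable {𝔸 : Type u} {Γ : Type u} [MulAction (FinPerm 𝔸) Γ]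

/-- The letterwise action on words. -/
instance : MulDistribMulAction (FinPerm 𝔸) (FreeMonoid Γ) where
  smul π w := FreeMonoid.map (π • ·) w
  one_smul w := by
    change FreeMonoid.map (fun a => (1 : FinPerm 𝔸) • a) w = w
    simp only [one_smul]
    exact DFunLike.congr_fun FreeMonoid.map_id w
  mul_smul π σ w := by
    change FreeMonoid.map _ w = FreeMonoid.map _ (FreeMonoid.map _ w)
    rw [FreeMonoid.map_map]
    congr 2
    funext a
    exact mul_smul π σ a
  smul_one π := map_one _
  smul_mul π v w := map_mul _ v w

instance [Nominal 𝔸 Γ] : Nominal 𝔸 (FreeMonoid Γ) where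
  finSupp w := by
    induction w using FreeMonoid.inductionOn' with
    | one => exact ⟨∅, Set.finite_empty, fun π _ => smul_one π⟩
    | of_mul a w ih =>
      obtain ⟨S, hS, h⟩ := ih
      obtain ⟨T, hT, h'⟩ := Nominal.finSupp (𝔸 := 𝔸) a
      refine ⟨S ∪ T, hS.union hT, fun π hπ => ?_⟩
      rw [smul_mul', h π fun _ ha => hπ (Or.inl ha)]
      congr 1
      change FreeMonoid.of (π • a) = _
      rw [h' π fun _ ha => hπ (Or.inr ha)]

variable (𝔸 Γ) in
/-- Support bounds on words over the alphabet `Γ`: maps from words to sets of names of size at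
most `k`, for some `k`. -/
structure SupportBound where
  toFun : FreeMonoid Γ → Set 𝔸
  bounded : ∃ k : ℕ, ∀ w, (toFun w).encard ≤ k

variable (𝔸 Γ) in
/-- Equivariant congruences on the free monoid. -/
structure EquivariantCon extends Con (FreeMonoid Γ) where
  smul' : ∀ (π : FinPerm 𝔸) (v w : FreeMonoid Γ), toCon v w → toCon (π • v) (π • w)

/-- The quotient monoid of an equivariant congruence. -/
def EquivariantCon.Quotient (c : EquivariantCon 𝔸 Γ) : Type u := c.toCon.Quotient

instance (c : EquivariantCon 𝔸 Γ) : Monoid c.Quotient :=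
  inferInstanceAs (Monoid c.toCon.Quotient)

/-- The induced action on the quotient monoid, `π • [w] = [π • w]`. -/
instance (c : EquivariantCon 𝔸 Γ) : MulDistribMulAction (FinPerm 𝔸) c.Quotient where
  smul π := Quotient.map' (π • ·) (fun v w h => c.smul' π v w h)
  one_smul q := by
    induction q using Con.induction_on with
    | H w => exact congrArg _ (one_smul _ w)
  mul_smul π σ q := by
    induction q using Con.induction_on with
    | H w => exact congrArg _ (mul_smul π σ w)
  smul_one π := congrArg (fun w : FreeMonoid Γ => (w : c.toCon.Quotient)) (smul_one π)
  smul_mul π p q := by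
    induction p, q using Con.induction_on₂ with
    | H v w => exact congrArg (fun w : FreeMonoid Γ => (w : c.toCon.Quotient)) (smul_mul' π v w)

/-- The canonical projection from words to the quotient monoid. -/
def EquivariantCon.proj (c : EquivariantCon 𝔸 Γ) : FreeMonoid Γ →*[FinPerm 𝔸] c.Quotient where
  toFun w := (w : c.toCon.Quotient)
  map_smul' _ _ := rfl
  map_one' := rfl
  map_mul' _ _ := rfl

theorem EquivariantCon.proj_surjective (c : EquivariantCon 𝔸 Γ) :
    Function.Surjective c.proj := by
  intro q
  induction q using Con.induction_on with
  | H w => exact ⟨w, rfl⟩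

instance [Nominal 𝔸 Γ] (c : EquivariantCon 𝔸 Γ) : Nominal 𝔸 c.Quotient where
  finSupp q := by
    obtain ⟨w, rfl⟩ := c.proj_surjective q
    obtain ⟨S, hS, h⟩ := Nominal.finSupp (𝔸 := 𝔸) w
    exact ⟨S, hS, supports_map c.proj.toMulActionHom h⟩

/-- A morphism from words into a nominal monoid is `s`-bounded if `supp (h w) ⊆ s w` for all
words `w`. -/
def SupportBound.Bounds (s : SupportBound 𝔸 Γ) {M : Type u} [Monoid M]
    [MulDistribMulAction (FinPerm 𝔸) M] (h : FreeMonoid Γ →*[FinPerm 𝔸] M) : Prop :=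
  ∀ w, supp 𝔸 (h w) ⊆ s.toFun w

/-- The `s`-bounded orbit-finite quotient monoids of the free monoid. A quotient, that is, an
isomorphism class of surjective equivariant morphisms, is given by its kernel, an equivariant
congruence. -/
structure SBoundedQuotient (s : SupportBound 𝔸 Γ) extends EquivariantCon 𝔸 Γ where
  orbitFinite : OrbitFinite 𝔸 toEquivariantCon.Quotient
  sBounded : s.Bounds toEquivariantCon.proj

/-- The order on quotients: `c ≤ d` if the projection to the quotient by `d` factorizes through
the projection to the quotient by `c`. -/
instance (s : SupportBound 𝔸 Γ) : LE (SBoundedQuotient s) := ⟨fun c d => c.toCon ≤ d.toCon⟩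

variable {s : SupportBound 𝔸 Γ}

instance (c : SBoundedQuotient s) : OrbitFinite 𝔸 c.Quotient := c.orbitFinite

/-- The connecting morphisms between the quotient monoids, `[w] ↦ [w]`. -/
def SBoundedQuotient.trans {c d : SBoundedQuotient s} (h : c ≤ d) :
    c.Quotient →*[FinPerm 𝔸] d.Quotient where
  toFun := Con.map c.toCon d.toCon h
  map_smul' π q := by
    obtain ⟨w, rfl⟩ := c.proj_surjective q
    rfl
  map_one' := map_one _
  map_mul' := map_mul _

variable (s) in
/-- The monoid of all finitely supported compatible families over the codirected poset of
`s`-bounded orbit-finite quotient monoids, with the componentwise structure. -/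
def proWordSubmonoid : Submonoid (∀ c : SBoundedQuotient s, c.Quotient) where
  carrier := {x | (∀ c d (h : c ≤ d), SBoundedQuotient.trans h (x c) = x d) ∧
    FinSupp 𝔸 x}
  one_mem' := ⟨fun _ _ h => map_one (SBoundedQuotient.trans h),
    ∅, Set.finite_empty, fun π _ => funext fun c => smul_one (N := c.Quotient) π⟩
  mul_mem' := by
    rintro x y ⟨hx, S, hS, hSx⟩ ⟨hy, T, hT, hTy⟩
    refine ⟨fun c d h => ?_, S ∪ T, hS.union hT, fun π hπ => ?_⟩
    · change SBoundedQuotient.trans h (x c * y c) = x d * y d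
      rw [map_mul, hx c d h, hy c d h]
    · have h1 := hSx π fun _ ha => hπ (Or.inl ha)
      have h2 := hTy π fun _ ha => hπ (Or.inr ha)
      funext c
      change π • (x c * y c) = x c * y c
      rw [smul_mul']
      exact congrArg₂ _ (congrFun h1 c) (congrFun h2 c)

variable (s) in
/-- The nominal monoid of `s`-bounded pro-orbit-finite words over `Γ`: the limit of the diagram
of all `s`-bounded orbit-finite quotient monoids of the free monoid over `Γ`. -/
abbrev ProWord : Type u := proWordSubmonoid s

instance : MulDistribMulAction (FinPerm 𝔸) (ProWord s) where
  smul π x := ⟨π • x.1, fun c d h => by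
    change SBoundedQuotient.trans h (π • x.1 c) = π • x.1 d
    rw [map_smul, x.2.1 c d h], x.2.2.smul π⟩
  one_smul x := Subtype.ext (one_smul _ x.1)
  mul_smul π σ x := Subtype.ext (mul_smul π σ x.1)
  smul_one π := Subtype.ext (funext fun c => smul_one (N := c.Quotient) π)
  smul_mul π x y := Subtype.ext (funext fun c => smul_mul' (N := c.Quotient) π (x.1 c) (y.1 c))

instance : Nominal 𝔸 (ProWord s) where
  finSupp x := by
    obtain ⟨S, hS, h⟩ := x.2.2
    exact ⟨S, hS, fun π hπ => Subtype.ext (h π hπ)⟩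

/-- The limit projections. -/
def ProWord.proj (c : SBoundedQuotient s) : ProWord s →*[FinPerm 𝔸] c.Quotient where
  toFun x := x.1 c
  map_smul' _ _ := rfl
  map_one' := rfl
  map_mul' _ _ := rfl

variable (s) in
/-- The limit topology on pro-orbit-finite words: the initial topology with respect to the
limit projections into the discrete quotient monoids. -/
def ProWord.top : NomTop 𝔸 (ProWord s) :=
  NomTop.initial (fun c : SBoundedQuotient s => (ProWord.proj c).toMulActionHom)
    (fun c => NomTop.discrete 𝔸 c.Quotient)

/-! Pro-orbit-finite words form a nominal Stone space. -/

variable [Infinite 𝔸] [Nominal 𝔸 Γ]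

set_option linter.unusedSectionVars false

theorem SBoundedQuotient.exists_bound (s : SupportBound 𝔸 Γ) :
    ∃ k : ℕ, ∀ (c : SBoundedQuotient s) (q : c.Quotient), (supp 𝔸 q).ncard ≤ k := by
  obtain ⟨k, hk⟩ := s.bounded
  refine ⟨k, fun c q => ?_⟩
  obtain ⟨w, rfl⟩ := c.proj_surjective q
  have h1 := (Set.encard_le_encard (c.sBounded w)).trans (hk w)
  rw [← (supp_finite (𝔸 := 𝔸) (c.proj w)).cast_ncard_eq] at h1
  exact_mod_cast h1

/-- The poset of `s`-bounded orbit-finite quotient monoids is codirected. -/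
theorem SBoundedQuotient.exists_le (c d : SBoundedQuotient s) : ∃ e, e ≤ c ∧ e ≤ d := by
  let e : EquivariantCon 𝔸 Γ :=
    { c.toCon ⊓ d.toCon with
      smul' := fun π v w h => ⟨c.smul' π v w h.1, d.smul' π v w h.2⟩ }
  have key : ∀ (S : Set 𝔸) w, Supports (FinPerm 𝔸) S (c.proj w) →
      Supports (FinPerm 𝔸) S (d.proj w) → Supports (FinPerm 𝔸) S (e.proj w) := by
    intro S w h1 h2 π hπ
    have h1 := h1 π hπ
    have h2 := h2 π hπ
    exact (Con.eq (c.toCon ⊓ d.toCon)).2 ⟨(Con.eq c.toCon).1 h1, (Con.eq d.toCon).1 h2⟩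
  have hb : s.Bounds e.proj := by
    intro w
    refine (supp_subset ((supp_finite (c.proj w)).union (supp_finite (d.proj w)))
      (key _ w ((supports_supp _).mono Set.subset_union_left)
        ((supports_supp _).mono Set.subset_union_right))).trans ?_
    exact Set.union_subset (c.sBounded w) (d.sBounded w)
  let pc : e.Quotient →[FinPerm 𝔸] c.Quotient :=
    ⟨Con.map e.toCon c.toCon (fun {_ _} h => h.1), fun π q => by
      obtain ⟨w, rfl⟩ := e.proj_surjective q; rfl⟩
  let pd : e.Quotient →[FinPerm 𝔸] d.Quotient :=
    ⟨Con.map e.toCon d.toCon (fun {_ _} h => h.2), fun π q => by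
      obtain ⟨w, rfl⟩ := e.proj_surjective q; rfl⟩
  have hof : OrbitFinite 𝔸 e.Quotient := by
    obtain ⟨k, hk⟩ := s.bounded
    obtain ⟨T, hT⟩ := Infinite.exists_subset_card_eq 𝔸 k
    refine orbitFinite_of_finite (T : Set 𝔸) ?_ ?_
    · refine Set.Finite.of_finite_image (f := fun q => (pc q, pd q)) ?_ ?_
      · refine ((finite_supports (X := c.Quotient) (T : Set 𝔸) T.finite_toSet).prod
          (finite_supports (X := d.Quotient) (T : Set 𝔸) T.finite_toSet)).subset ?_
        rintro _ ⟨q, hq, rfl⟩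
        exact ⟨supports_map pc hq, supports_map pd hq⟩
      · intro q _ q' _ h
        obtain ⟨w, rfl⟩ := e.proj_surjective q
        obtain ⟨w', rfl⟩ := e.proj_surjective q'
        have h1 : pc (e.proj w) = pc (e.proj w') := congrArg Prod.fst h
        have h2 : pd (e.proj w) = pd (e.proj w') := congrArg Prod.snd h
        exact (Con.eq (c.toCon ⊓ d.toCon)).2 ⟨(Con.eq c.toCon).1 h1, (Con.eq d.toCon).1 h2⟩
    · intro q
      refine exists_smul_supports q _ T.finite_toSet ?_
      obtain ⟨w, rfl⟩ := e.proj_surjective q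
      have h1 := (Set.encard_le_encard (hb w)).trans (hk w)
      rw [← (supp_finite (𝔸 := 𝔸) (e.proj w)).cast_ncard_eq] at h1
      rw [Set.ncard_coe_finset, hT]
      exact_mod_cast h1
  exact ⟨⟨e, hof, hb⟩, fun {_ _} h => h.1, fun {_ _} h => h.2⟩

namespace ProWord

theorem eq_of_le (x y : ProWord s) {c d : SBoundedQuotient s} (h : c ≤ d)
    (hc : x.1 c = y.1 c) : x.1 d = y.1 d := by
  rw [← x.2.1 c d h, ← y.2.1 c d h, hc]

theorem exists_nhd {U : Set (ProWord s)} (hU : U ∈ (top s).opens) :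
    ∀ x ∈ U, ∃ c, ∀ y : ProWord s, y.1 c = x.1 c → y ∈ U := by
  change NomTop.GenOpen 𝔸 _ U at hU
  induction hU with
  | basic U hU =>
    obtain ⟨c, V, -, rfl⟩ : ∃ (c : SBoundedQuotient s) (V : Set c.Quotient), FinSupp 𝔸 V ∧
      U = ProWord.proj c ⁻¹' V := hU
    intro x hx
    refine ⟨c, fun y hy => ?_⟩
    have hx : x.1 c ∈ V := hx
    change y.1 c ∈ V
    rwa [hy]
  | univ =>
    intro x _
    let t : EquivariantCon 𝔸 Γ := { (⊤ : Con (FreeMonoid Γ)) with smul' := fun _ _ _ _ => trivial }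
    have hsub : ∀ p q : t.Quotient, p = q := fun p q => by
      obtain ⟨v, rfl⟩ := t.proj_surjective p
      obtain ⟨w, rfl⟩ := t.proj_surjective q
      exact (Con.eq (⊤ : Con (FreeMonoid Γ))).2 trivial
    have hfin : Finite t.Quotient := @Finite.of_subsingleton _ ⟨hsub⟩
    refine ⟨⟨t, ⟨Quotient.finite _⟩, fun w a ha => ?_⟩, fun _ _ => trivial⟩
    exact (ha ∅ Set.finite_empty fun _ _ => hsub _ _).elim
  | inter U V _ _ ihU ihV =>
    intro x hx
    obtain ⟨c, hc⟩ := ihU x hx.1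
    obtain ⟨d, hd⟩ := ihV x hx.2
    obtain ⟨e, hec, hed⟩ := SBoundedQuotient.exists_le c d
    exact ⟨e, fun y hy => ⟨hc y (eq_of_le y x hec hy), hd y (eq_of_le y x hed hy)⟩⟩
  | sUnion 𝒰 _ _ ih =>
    rintro x ⟨U, hU, hx⟩
    obtain ⟨c, hc⟩ := ih U hU x hx
    exact ⟨c, fun y hy => ⟨U, hU, hc y hy⟩⟩

variable (s) in
/-- The basic open sets `{x | x c = q}`. -/
def cylinders : Set (Set (ProWord s)) :=
  {E | ∃ (c : SBoundedQuotient s) (q : c.Quotient), E = ProWord.proj c ⁻¹' {q}}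

theorem cylinders_smul (π : FinPerm 𝔸) : ∀ E ∈ cylinders s, π • E ∈ cylinders s := by
  rintro _ ⟨c, q, rfl⟩
  refine ⟨c, π • q, ?_⟩
  have := smul_preimage (ProWord.proj c).toMulActionHom π {q}
  rw [Set.smul_set_singleton] at this
  exact this

theorem cylinders_open : cylinders s ⊆ (top s).opens := by
  rintro _ ⟨c, q, rfl⟩
  exact NomTop.GenOpen.basic _ ⟨c, {q}, FinSupp.singleton (Nominal.finSupp q), rfl⟩

theorem continuous_proj (c : SBoundedQuotient s) :
    NomTop.Continuous (top s) (NomTop.discrete 𝔸 c.Quotient) (ProWord.proj c) :=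
  fun U hU => NomTop.GenOpen.basic _ ⟨c, U, hU, rfl⟩

theorem exists_cylinder {U : Set (ProWord s)} (hU : U ∈ (top s).opens) :
    ∀ x ∈ U, ∃ E ∈ cylinders s, x ∈ E ∧ E ⊆ U := by
  intro x hx
  obtain ⟨c, hc⟩ := exists_nhd hU x hx
  exact ⟨_, ⟨c, x.1 c, rfl⟩, rfl, fun y hy => hc y hy⟩

theorem supp_coord_subset (x : ProWord s) {c d : SBoundedQuotient s} (h : c ≤ d) :
    supp 𝔸 (x.1 d) ⊆ supp 𝔸 (x.1 c) := by
  rw [← x.2.1 c d h]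
  exact supp_map_subset (SBoundedQuotient.trans h).toMulActionHom (x.1 c)

theorem exists_supp_eq [Nonempty (SBoundedQuotient s)] (x : ProWord s) :
    ∃ c, supp 𝔸 x ⊆ supp 𝔸 (x.1 c) := by
  obtain ⟨k, hk⟩ := SBoundedQuotient.exists_bound s
  obtain ⟨c, hc⟩ : ∃ c, ∀ d, (supp 𝔸 (x.1 d)).ncard ≤ (supp 𝔸 (x.1 c)).ncard := by
    obtain ⟨m, ⟨c, rfl⟩, hm⟩ := Set.Finite.exists_maximal
      (s := Set.range fun c => (supp 𝔸 (x.1 c)).ncard)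
      ((Set.finite_Iic k).subset (by rintro _ ⟨c, rfl⟩; exact hk c _)) (Set.range_nonempty _)
    exact ⟨c, fun d => (le_total _ _).elim id fun h => hm ⟨d, rfl⟩ h⟩
  refine ⟨c, supp_subset (supp_finite _) fun π hπ => Subtype.ext (funext fun d => ?_)⟩
  obtain ⟨e, hec, hed⟩ := SBoundedQuotient.exists_le c d
  have heq : supp 𝔸 (x.1 c) = supp 𝔸 (x.1 e) :=
    Set.eq_of_subset_of_ncard_le (supp_coord_subset x hec) (hc e) (supp_finite _)
  have : Supports (FinPerm 𝔸) (supp 𝔸 (x.1 c)) (x.1 d) :=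
    (supports_supp _).mono ((supp_coord_subset x hed).trans heq.symm.subset)
  exact this π hπ

theorem nonempty_quotients : Nonempty (SBoundedQuotient s) := by
  obtain ⟨c, -⟩ := exists_nhd (s := s) (U := Set.univ) (top s).univ_mem 1 trivial
  exact ⟨c⟩

theorem isCompact : (top s).IsCompact := by
  intro 𝒞 hop _ hcov
  have := nonempty_quotients (s := s)
  obtain ⟨k, hk⟩ := SBoundedQuotient.exists_bound s
  obtain ⟨T, hT⟩ := Infinite.exists_subset_card_eq 𝔸 k
  let _ : ∀ c : SBoundedQuotient s, TopologicalSpace c.Quotient := fun _ => ⊥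
  have : ∀ c : SBoundedQuotient s, DiscreteTopology c.Quotient := fun _ => ⟨rfl⟩
  let K : Set (∀ c : SBoundedQuotient s, c.Quotient) :=
    Set.pi Set.univ (fun c => {q : c.Quotient | Supports (FinPerm 𝔸) (T : Set 𝔸) q}) ∩
      ⋂ (c) (d) (h : c ≤ d), {x | SBoundedQuotient.trans h (x c) = x d}
  have hK : _root_.IsCompact K := by
    refine IsCompact.inter_right (isCompact_univ_pi fun c =>
      (finite_supports (X := c.Quotient) (T : Set 𝔸) T.finite_toSet).isCompact) ?_
    refine isClosed_iInter fun c => isClosed_iInter fun d => isClosed_iInter fun h => ?_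
    exact isClosed_eq (continuous_of_discreteTopology.comp (continuous_apply c))
      (continuous_apply d)
  let O : Set (ProWord s) → Set (∀ c : SBoundedQuotient s, c.Quotient) := fun U =>
    ⋃ (x ∈ U) (c) (_ : ∀ z : ProWord s, z.1 c = x.1 c → z ∈ U), {y | y c = x.1 c}
  obtain ⟨ℱ, hℱ, hfin, hKF⟩ := hK.elim_finite_subcover_image (b := 𝒞) (c := O)
    (by
      intro U _
      refine isOpen_biUnion fun x _ => isOpen_iUnion fun c => isOpen_iUnion fun _ => ?_
      have hcont := continuous_apply (A := fun c : SBoundedQuotient s => c.Quotient) c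
      exact hcont.isOpen_preimage _ (isOpen_discrete {q : c.Quotient | q = x.1 c}))
    (by
      rintro y ⟨hyT, hyc⟩
      simp only [Set.mem_iInter, Set.mem_ofPred_eq] at hyc
      let x : ProWord s := ⟨y, hyc, T, T.finite_toSet, fun π hπ => funext fun c =>
        hyT c trivial π hπ⟩
      obtain ⟨U, hU, hx⟩ : x ∈ ⋃₀ 𝒞 := hcov ▸ trivial
      obtain ⟨c, hc⟩ := exists_nhd (hop hU) x hx
      refine Set.mem_iUnion₂.2 ⟨U, hU, ?_⟩
      exact Set.mem_iUnion₂.2 ⟨x, hx, Set.mem_iUnion₂.2 ⟨c, hc, rfl⟩⟩)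
  refine ⟨ℱ, hℱ, hfin, Set.eq_univ_iff_forall.2 fun x => ?_⟩
  obtain ⟨c, hc⟩ := exists_supp_eq x
  obtain ⟨π, hπ⟩ := exists_smul_supports x (T : Set 𝔸) T.finite_toSet (by
    rw [Set.ncard_coe_finset, hT]
    exact (Set.ncard_le_ncard hc (supp_finite _)).trans (hk c _))
  have hmem : (π • x).1 ∈ K := by
    refine ⟨fun d _ => supports_map (ProWord.proj d).toMulActionHom hπ, ?_⟩
    simp only [Set.mem_iInter]
    exact (π • x).2.1
  obtain ⟨U, hU, h⟩ := Set.mem_iUnion₂.1 (hKF hmem)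
  obtain ⟨x', hx', h⟩ := Set.mem_iUnion₂.1 h
  obtain ⟨d, hd, h⟩ := Set.mem_iUnion₂.1 h
  have hxU : π • x ∈ U := hd _ h
  refine Set.mem_iUnion₂.2 ⟨U, hU, π⁻¹ • U, ⟨π⁻¹, rfl⟩, ?_⟩
  rwa [Set.mem_smul_set_iff_inv_smul_mem, inv_inv]

/-- Two words whose components lie in the same `S`-orbits lie in the same `S`-orbit. -/
theorem exists_smul_eq (S : Set 𝔸) (hS : S.Finite) (x y : ProWord s)
    (h : ∀ c, ∃ π : FinPerm 𝔸, (∀ a ∈ S, π • a = a) ∧ π • x.1 c = y.1 c) :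
    ∃ π : FinPerm 𝔸, (∀ a ∈ S, π • a = a) ∧ π • x = y := by
  classical
  have := nonempty_quotients (s := s)
  obtain ⟨X, hX, hXx⟩ := Nominal.finSupp (𝔸 := 𝔸) x
  obtain ⟨Y, hY, hYy⟩ := Nominal.finSupp (𝔸 := 𝔸) y
  let W : Set 𝔸 := S ∪ (X ∪ Y)
  have hW : W.Finite := hS.union (hX.union hY)
  let P : Set (FinPerm 𝔸) := {π | ∀ a, a ∉ W → π • a = a}
  have hP : P.Finite := by
    have : Finite W := hW
    refine Set.Finite.of_injOn (f := fun π : FinPerm 𝔸 => fun a : W => π • (a : 𝔸))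
      (t := {f | ∀ a : W, f a ∈ W}) ?_ ?_ (Set.Finite.pi' fun _ => hW)
    · intro π hπ a
      by_contra hn
      have h1 := hπ _ hn
      have h2 : π • (a : 𝔸) = a := smul_left_cancel π h1
      have h3 := a.2
      rw [← h2] at h3
      exact hn h3
    · intro π hπ σ hσ hEq
      refine Subtype.ext (Equiv.ext fun a => ?_)
      by_cases ha : a ∈ W
      · exact congrFun hEq ⟨a, ha⟩
      · exact (hπ a ha).trans (hσ a ha).symm
  let K : SBoundedQuotient s → Set (FinPerm 𝔸) := fun c =>
    {π | π ∈ P ∧ (∀ a ∈ S, π • a = a) ∧ π • x.1 c = y.1 c}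
  have hKP : ∀ c, K c ⊆ P := fun c π hπ => hπ.1
  have hKmono : ∀ {c d : SBoundedQuotient s}, c ≤ d → K c ⊆ K d := by
    rintro c d hcd π ⟨h1, h2, h3⟩
    exact ⟨h1, h2, eq_of_le (π • x) y hcd h3⟩
  have hKne : ∀ c, (K c).Nonempty := by
    intro c
    obtain ⟨π, hπS, hπ⟩ := h c
    have hxX : supp 𝔸 (x.1 c) ⊆ W :=
      (supp_subset hX (supports_map (ProWord.proj c).toMulActionHom hXx)).trans
        (Set.subset_union_left.trans Set.subset_union_right)
    have hyY : supp 𝔸 (y.1 c) ⊆ W :=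
      (supp_subset hY (supports_map (ProWord.proj c).toMulActionHom hYy)).trans
        (Set.subset_union_right.trans Set.subset_union_right)
    have hπx : ∀ a ∈ supp 𝔸 (x.1 c), π • a ∈ W := by
      intro a ha
      apply hyY
      have := supp_smul_subset π⁻¹ (y.1 c)
      rw [← hπ, inv_smul_smul, hπ] at this
      have := this ha
      rwa [Set.mem_smul_set_iff_inv_smul_mem, inv_inv] at this
    obtain ⟨σ, hσ, hσ'⟩ := exists_extension (S ∪ supp 𝔸 (x.1 c))
      (hS.union (supp_finite _)) (fun a => π • a) (fun a _ b _ hab => smul_left_cancel π hab)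
    refine ⟨σ, fun a ha => hσ' a ?_ ?_, fun a ha => ?_, ?_⟩
    · rintro (h | h)
      exacts [ha (Or.inl h), ha (hxX h)]
    · rintro ⟨b, hb | hb, rfl⟩
      · have h1 := hb
        rw [← hπS b hb] at h1
        exact ha (Or.inl h1)
      · exact ha (hπx b hb)
    · rw [hσ a (Or.inl ha), hπS a ha]
    · rw [← hπ, ← inv_smul_eq_iff, ← mul_smul]
      refine supports_fix (supports_supp _) fun a ha => ?_
      rw [mul_smul, inv_smul_eq_iff, hσ a (Or.inr ha)]
  obtain ⟨m, ⟨c, rfl⟩, hm⟩ : ∃ m ∈ Set.range fun c => (K c).ncard,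
      ∀ n ∈ Set.range fun c => (K c).ncard, m ≤ n := by
    have hne : (Set.range fun c => (K c).ncard).Nonempty := Set.range_nonempty _
    exact ⟨_, Nat.sInf_mem hne, fun n hn => Nat.sInf_le hn⟩
  obtain ⟨π, hπ⟩ := hKne c
  refine ⟨π, hπ.2.1, Subtype.ext (funext fun d => ?_)⟩
  obtain ⟨e, hec, hed⟩ := SBoundedQuotient.exists_le c d
  have heq : K e = K c :=
    Set.eq_of_subset_of_ncard_le (hKmono hec) (hm _ ⟨e, rfl⟩) (hP.subset (hKP c))
  exact (hKmono hed (heq ▸ hπ)).2.2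

theorem isHausdorff : (top s).IsHausdorff := by
  intro S hS x y hxy
  obtain ⟨c, hc⟩ : ∃ c, ¬ ∃ π : FinPerm 𝔸, (∀ a ∈ S, π • a = a) ∧ π • x.1 c = y.1 c := by
    by_contra! h
    exact hxy (exists_smul_eq S hS x y h)
  obtain ⟨U, hU, V, hV, hSU, hSV, hxU, hyV, hUV⟩ :=
    (NomTop.isStone_discrete (𝔸 := 𝔸) (X := c.Quotient)).hausdorff S hS _ _ hc
  exact ⟨_, continuous_proj c U hU, _, continuous_proj c V hV,
    supports_preimage (ProWord.proj c).toMulActionHom hSU,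
    supports_preimage (ProWord.proj c).toMulActionHom hSV, hxU, hyV, hUV.preimage _⟩

theorem isStone : (top s).IsStone where
  compact := isCompact
  hausdorff := isHausdorff
  basis := by
    refine ⟨cylinders s, ⟨cylinders_open, cylinders_smul, fun U hU =>
      NomTop.exists_finSupp_sUnion cylinders_smul ((top s).finSupp U hU)
        (exists_cylinder hU)⟩, ?_⟩
    rintro _ ⟨c, q, rfl⟩
    exact ⟨c.Quotient, inferInstance, inferInstance, inferInstance,
      (ProWord.proj c).toMulActionHom, continuous_proj c, {q},
      FinSupp.singleton (Nominal.finSupp q), rfl⟩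

theorem continuous_mul :
    NomTop.Continuous ((top s).prod (top s)) (top s) (fun p => p.1 * p.2) := by
  intro U hU
  refine NomTop.mem_opens_of_nhds _ (ℰ := {E | ∃ A ∈ cylinders s, ∃ B ∈ cylinders s, E = A ×ˢ B})
    ?_ ?_ (FinSupp.preimage (⟨fun p => p.1 * p.2, fun π p => (smul_mul' π p.1 p.2).symm⟩ :
      ProWord s × ProWord s →[FinPerm 𝔸] ProWord s) ((top s).finSupp U hU)) ?_
  · rintro _ ⟨A, hA, B, hB, rfl⟩
    exact NomTop.prod_mem _ _ (cylinders_open hA) (cylinders_open hB)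
  · rintro π _ ⟨A, hA, B, hB, rfl⟩
    exact ⟨π • A, cylinders_smul π A hA, π • B, cylinders_smul π B hB, NomTop.smul_prod π A B⟩
  · rintro ⟨x, y⟩ h
    obtain ⟨c, hc⟩ := exists_nhd hU _ h
    refine ⟨_, ⟨_, ⟨c, x.1 c, rfl⟩, _, ⟨c, y.1 c, rfl⟩, rfl⟩, ⟨rfl, rfl⟩, ?_⟩
    rintro ⟨x', y'⟩ ⟨hx', hy'⟩
    refine hc _ ?_
    have hx' : x'.1 c = x.1 c := hx'
    have hy' : y'.1 c = y.1 c := hy'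
    change x'.1 c * y'.1 c = x.1 c * y.1 c
    rw [hx', hy']

end ProWord

end Words

/-! ## Monoids in nominal Stone spaces -/

open CategoryTheory

/-- Monoids in nominal Stone spaces: nominal Stone spaces with the structure of a nominal
monoid whose multiplication is continuous. -/
structure NStoneMon (𝔸 : Type u) where
  carrier : Type u
  [monoid : Monoid carrier]
  [action : MulDistribMulAction (FinPerm 𝔸) carrier]
  [nominal : Nominal 𝔸 carrier]
  top : NomTop 𝔸 carrier
  isStone : top.IsStone
  continuous_mul : NomTop.Continuous (top.prod top) top (fun p : carrier × carrier => p.1 * p.2)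

attribute [instance] NStoneMon.monoid NStoneMon.action NStoneMon.nominal

namespace NStoneMon

/-- Morphisms: continuous equivariant monoid morphisms. -/
@[ext]
structure Hom {𝔸 : Type u} (X Y : NStoneMon 𝔸) where
  toHom : X.carrier →*[FinPerm 𝔸] Y.carrier
  continuous : NomTop.Continuous X.top Y.top toHom

/-- The category of monoids in nominal Stone spaces. -/
instance (𝔸 : Type u) : Category (NStoneMon 𝔸) where
  Hom := Hom
  id X := ⟨MulDistribMulActionHom.id _, fun _ hU => hU⟩
  comp f g := ⟨g.toHom.comp f.toHom, fun U hU => f.continuous _ (g.continuous U hU)⟩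

/-- An orbit-finite nominal monoid, regarded as a discrete space. -/
def ofDiscrete (𝔸 : Type u) (M : Type u) [Monoid M] [MulDistribMulAction (FinPerm 𝔸) M]
    [Nominal 𝔸 M] [OrbitFinite 𝔸 M] : NStoneMon 𝔸 where
  carrier := M
  top := NomTop.discrete 𝔸 M
  isStone := NomTop.isStone_discrete
  continuous_mul := NomTop.continuous_mul_discrete fun π p => (smul_mul' π p.1 p.2).symm

/-- An equivariant morphism of orbit-finite nominal monoids, regarded as a morphism of discrete
spaces. -/
def homOfDiscrete {𝔸 : Type u} {M N : Type u}
    [Monoid M] [MulDistribMulAction (FinPerm 𝔸) M] [Nominal 𝔸 M] [OrbitFinite 𝔸 M]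
    [Monoid N] [MulDistribMulAction (FinPerm 𝔸) N] [Nominal 𝔸 N] [OrbitFinite 𝔸 N]
    (e : M →*[FinPerm 𝔸] N) : ofDiscrete 𝔸 M ⟶ ofDiscrete 𝔸 N :=
  Hom.mk (X := ofDiscrete 𝔸 M) (Y := ofDiscrete 𝔸 N) e
    (fun _ hU => FinSupp.preimage e.toMulActionHom hU)

/-- The monoid of `s`-bounded pro-orbit-finite words. -/
def proWords {𝔸 : Type u} [Infinite 𝔸] {Γ : Type u} [MulAction (FinPerm 𝔸) Γ] [Nominal 𝔸 Γ]
    (s : SupportBound 𝔸 Γ) : NStoneMon 𝔸 where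
  carrier := ProWord s
  top := ProWord.top s
  isStone := ProWord.isStone
  continuous_mul := ProWord.continuous_mul

end NStoneMon

/-- `P` is projective with respect to `e`: every morphism from `P` to the codomain of `e`
factorizes through `e`. -/
def ProjectiveWrt {C : Type*} [Category C] (P : C) {M N : C} (e : M ⟶ N) : Prop :=
  ∀ f : P ⟶ N, ∃ g : P ⟶ M, g ≫ e = f

/-- Multiplicatively support-reflecting morphisms: the restriction to some nominal submonoid is
surjective and support-preserving. -/
def IsMSR {𝔸 : Type u} {M N : Type u} [Monoid M] [MulDistribMulAction (FinPerm 𝔸) M]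
    [Monoid N] [MulDistribMulAction (FinPerm 𝔸) N] (e : M →*[FinPerm 𝔸] N) : Prop :=
  ∃ M' : Submonoid M, (∀ (π : FinPerm 𝔸), ∀ x ∈ M', π • x ∈ M') ∧
    (∀ y : N, ∃ x ∈ M', e x = y) ∧ ∀ x ∈ M', supp 𝔸 (e x) = supp 𝔸 x

end NomMon

namespace NomMon

open MulAction (Supports)
open CategoryTheory

/-! A continuous morphism from the pro-orbit-finite words to a discrete orbit-finite monoid is the
same thing as an `s`-bounded morphism on finite words. Existence of the extension
(`ProWord.exists_hom_extension`): a bounded morphism factors through its kernel quotient, which is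
one of the components of the limit. Uniqueness (`ProWord.eq_of_eq_ofWord`): finite words are dense.
Boundedness of a restriction: `s w` supports the image of `w` in the limit, and equivariant maps do
not enlarge supports.

If `e` is MSR, restrict a given morphism to finite words and lift it letter by letter into `M'`
(`IsMSR.exists_lift`). An equivariant choice of lifts requires the stabilizer of a letter to fix the
chosen element. Strongness gives this: the stabilizer fixes the support of the letter, which
contains the support of its image in `N`, and that equals the support of any preimage in `M'`. Since
`M'` is a submonoid, the lift of every word stays in `M'` and has the same support as its image, so
it is again `s`-bounded and extends to the limit.

Conversely, cover `N` by a strong orbit-finite alphabet (`exists_strong_cover`), let `h` be the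
induced surjection from words, and take the tightest support bound `s w = supp (h w)`. A lift of the
extension of `h` sends each word `w` to an element over `h w` with support inside `supp (h w)`. The
images of the words therefore form a submonoid witnessing MSR (`isMSR_of_projectiveWrt`). -/

/-- A relation between `G`-sets that is invariant and relates every `a` to some `x` fixed by the
stabilizer of `a` contains an equivariant map. -/
theorem exists_equivariant_choice {G A X : Type*} [Group G] [MulAction G A] [MulAction G X]
    (P : A → X → Prop) (hP : ∀ (g : G) a x, P a x → P (g • a) (g • x))
    (h : ∀ a, ∃ x, P a x ∧ ∀ g : G, g • a = a → g • x = x) :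
    ∃ f : A →[G] X, ∀ a, P a (f a) := by
  choose x hx hfix using h
  -- `r a` is the chosen representative of the orbit of `a`, and `t a` below carries it to `a`. The
  -- map is fixed on representatives by `x` and transported along `t`.
  let r : A → A := fun a => (Quotient.mk'' a : MulAction.orbitRel.Quotient G A).out
  have hr : ∀ (g : G) a, r (g • a) = r a := fun g a =>
    congrArg Quotient.out (Quotient.sound' (s₁ := MulAction.orbitRel G A) ⟨g, rfl⟩)
  have hra : ∀ a, ∃ g : G, g • r a = a := fun a =>
    (MulAction.orbitRel G A).symm (Quotient.mk_out (s := MulAction.orbitRel G A) a)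
  choose t ht using hra
  refine ⟨⟨fun a => t a • x (r a), fun g a => ?_⟩, fun a => ?_⟩
  -- Both `g * t a` and `t (g • a)` carry the representative to `g • a`. They differ by an element
  -- of its stabilizer, which fixes `x (r a)`.
  · have h1 : ((g * t a)⁻¹ * t (g • a)) • r a = r a := by
      rw [mul_smul, inv_smul_eq_iff, mul_smul, ht a, ← hr g a, ht]
    have h2 := hfix _ _ h1
    rw [mul_smul, inv_smul_eq_iff, mul_smul] at h2
    simpa only [hr, id_eq] using h2
  · have := hP (t a) _ _ (hx (r a))
    rwa [ht] at this

theorem SupportBound.finite {𝔸 Γ : Type u} (s : SupportBound 𝔸 Γ) (w : FreeMonoid Γ) : (s.toFun w).Finite := by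
  obtain ⟨k, hk⟩ := s.bounded
  exact Set.finite_of_encard_le_coe (hk w)

/-! ### Bounded morphisms on finite words and continuous morphisms on pro-orbit-finite words -/

section Words

variable {𝔸 Γ : Type u} [MulAction (FinPerm 𝔸) Γ]

/-- The equivariant extension of an equivariant map to words. -/
def freeLift {M : Type u} [Monoid M] [MulDistribMulAction (FinPerm 𝔸) M]
    (φ : Γ →[FinPerm 𝔸] M) : FreeMonoid Γ →*[FinPerm 𝔸] M where
  toFun := FreeMonoid.lift φ
  map_one' := map_one _
  map_mul' := map_mul _
  map_smul' π w := by
    induction w using FreeMonoid.inductionOn' with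
    | one => rw [smul_one, map_one]; exact (smul_one _).symm
    | of_mul a w ih =>
      change FreeMonoid.lift φ (π • w) = π • FreeMonoid.lift φ w at ih
      change FreeMonoid.lift φ (π • (FreeMonoid.of a * w)) =
        π • FreeMonoid.lift φ (FreeMonoid.of a * w)
      rw [smul_mul', map_mul, map_mul, smul_mul', ih]
      congr 1
      exact map_smul φ π a

theorem freeLift_of {M : Type u} [Monoid M] [MulDistribMulAction (FinPerm 𝔸) M]
    (φ : Γ →[FinPerm 𝔸] M) (a : Γ) : freeLift φ (FreeMonoid.of a) = φ a :=
  FreeMonoid.lift_eval_of _ _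

/-- The kernel of an equivariant morphism on words. -/
def EquivariantCon.ker {M : Type u} [Monoid M] [MulDistribMulAction (FinPerm 𝔸) M]
    (h : FreeMonoid Γ →*[FinPerm 𝔸] M) : EquivariantCon 𝔸 Γ :=
  { Con.ker (h : FreeMonoid Γ →* M) with
    smul' := fun π v w (hvw : h v = h w) => by
      change h (π • v) = h (π • w)
      rw [map_smul, map_smul, hvw] }

/-- The injective morphism induced on the quotient by the kernel. -/
def EquivariantCon.kerLift {M : Type u} [Monoid M] [MulDistribMulAction (FinPerm 𝔸) M]
    (h : FreeMonoid Γ →*[FinPerm 𝔸] M) : (EquivariantCon.ker h).Quotient →*[FinPerm 𝔸] M where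
  toFun := Con.kerLift (h : FreeMonoid Γ →* M)
  map_one' := map_one _
  map_mul' := map_mul _
  map_smul' π q := by
    obtain ⟨w, rfl⟩ := (EquivariantCon.ker h).proj_surjective q
    exact map_smul h π w

theorem EquivariantCon.kerLift_injective {M : Type u} [Monoid M]
    [MulDistribMulAction (FinPerm 𝔸) M] (h : FreeMonoid Γ →*[FinPerm 𝔸] M) :
    Function.Injective (EquivariantCon.kerLift h) :=
  Con.kerLift_injective (h : FreeMonoid Γ →* M)

/-- The induced map on orbits is injective too: `π • f y = f x` means `f (π • y) = f x`, hence `π •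
y = x`. -/
theorem OrbitFinite.of_injective {X Y : Type u} [MulAction (FinPerm 𝔸) X]
    [MulAction (FinPerm 𝔸) Y] [OrbitFinite 𝔸 Y] (f : X →[FinPerm 𝔸] Y)
    (hf : Function.Injective f) : OrbitFinite 𝔸 X := by
  have : Finite (MulAction.orbitRel.Quotient (FinPerm 𝔸) Y) := OrbitFinite.finite
  refine ⟨Finite.of_injective (β := MulAction.orbitRel.Quotient (FinPerm 𝔸) Y)
    (Quotient.map' f ?_) ?_⟩
  · rintro _ y ⟨π, rfl⟩
    exact ⟨π, (map_smul f π y).symm⟩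
  · intro p q
    induction p using Quotient.inductionOn' with | h x => ?_
    induction q using Quotient.inductionOn' with | h y => ?_
    intro hpq
    obtain ⟨π, hπ⟩ : (MulAction.orbitRel (FinPerm 𝔸) Y) (f x) (f y) := Quotient.exact' hpq
    refine Quotient.sound' ⟨π, hf ?_⟩
    rw [← hπ]
    exact map_smul f π y

variable {s : SupportBound 𝔸 Γ} [Infinite 𝔸] [Nominal 𝔸 Γ]

/-- The kernel of a bounded morphism into an orbit-finite monoid. -/
def SBoundedQuotient.ker {M : Type u} [Monoid M] [MulDistribMulAction (FinPerm 𝔸) M]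
    [Nominal 𝔸 M] [OrbitFinite 𝔸 M] (h : FreeMonoid Γ →*[FinPerm 𝔸] M) (hs : s.Bounds h) :
    SBoundedQuotient s where
  toEquivariantCon := EquivariantCon.ker h
  orbitFinite := OrbitFinite.of_injective (EquivariantCon.kerLift h).toMulActionHom
    (EquivariantCon.kerLift_injective h)
  sBounded w := by
    -- The embedding of the kernel quotient into `M` reflects supports, because it is injective and
    -- equivariant. So the class of `w` is supported by `supp (h w)`.
    refine (supp_subset (supp_finite (h w)) fun π hπ => ?_).trans (hs w)
    apply EquivariantCon.kerLift_injective h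
    rw [map_smul]
    exact supports_supp (h w) π hπ

namespace ProWord

variable (s) in
/-- Finite words as pro-orbit-finite words. -/
def ofWord : FreeMonoid Γ →*[FinPerm 𝔸] ProWord s where
  toFun w := ⟨fun c => c.proj w, fun _ _ _ => rfl, s.toFun w, s.finite w, fun _ hπ =>
    funext fun c => ((supports_supp (c.proj w)).mono (c.sBounded w)) _ hπ⟩
  map_smul' _ _ := rfl
  map_one' := rfl
  map_mul' _ _ := rfl

/-- Every quotient in the diagram is `s`-bounded, so the single finite set `s w` supports all
components simultaneously. This turns the bound on the quotients into a bound on the limit. -/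
theorem supp_ofWord_subset (w : FreeMonoid Γ) : supp 𝔸 (ofWord s w) ⊆ s.toFun w :=
  supp_subset (s.finite w) fun _ hπ => Subtype.ext <| funext fun c =>
    ((supports_supp (c.proj w)).mono (c.sBounded w)) _ hπ

/-- A bounded morphism on words extends continuously to pro-orbit-finite words. -/
theorem exists_hom_extension {M : Type u} [Monoid M] [MulDistribMulAction (FinPerm 𝔸) M]
    [Nominal 𝔸 M] [OrbitFinite 𝔸 M] (h : FreeMonoid Γ →*[FinPerm 𝔸] M) (hs : s.Bounds h) :
    ∃ g : ProWord s →*[FinPerm 𝔸] M,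
      NomTop.Continuous (top s) (NomTop.discrete 𝔸 M) g ∧ ∀ w, g (ofWord s w) = h w :=
  -- The kernel of `h` is itself an index of the limit. The extension is the projection to that
  -- component followed by the embedding into `M`.
  ⟨(EquivariantCon.kerLift h).comp (proj (SBoundedQuotient.ker h hs)),
    fun _ hU => continuous_proj (SBoundedQuotient.ker h hs) _
      (FinSupp.preimage (EquivariantCon.kerLift h).toMulActionHom hU), fun _ => rfl⟩

/-- A continuous map into a discrete space factorizes locally through the limit projections. -/
theorem exists_locally_eq {X : Type u} [MulAction (FinPerm 𝔸) X] [Nominal 𝔸 X]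
    {f : ProWord s → X} (hf : NomTop.Continuous (top s) (NomTop.discrete 𝔸 X) f)
    (x : ProWord s) : ∃ c, ∀ y : ProWord s, y.1 c = x.1 c → f y = f x :=
  exists_nhd (hf {f x} (FinSupp.singleton (Nominal.finSupp (f x)))) x rfl

/-- Finite words are dense. -/
theorem eq_of_eq_ofWord {X : Type u} [MulAction (FinPerm 𝔸) X] [Nominal 𝔸 X]
    {f g : ProWord s → X} (hf : NomTop.Continuous (top s) (NomTop.discrete 𝔸 X) f)
    (hg : NomTop.Continuous (top s) (NomTop.discrete 𝔸 X) g)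
    (h : ∀ w, f (ofWord s w) = g (ofWord s w)) : f = g := by
  funext x
  obtain ⟨c, hc⟩ := exists_locally_eq hf x
  obtain ⟨d, hd⟩ := exists_locally_eq hg x
  -- On a common refinement `b`, some finite word has the same component as `x`. Both maps then take
  -- the same value at this word as at `x`.
  obtain ⟨b, hbc, hbd⟩ := SBoundedQuotient.exists_le c d
  obtain ⟨w, hw⟩ := b.proj_surjective (x.1 b)
  have hw : (ofWord s w).1 b = x.1 b := hw
  rw [← hc _ (eq_of_le _ x hbc hw), h w, hd _ (eq_of_le _ x hbd hw)]

end ProWord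

end Words

/-! ### Covering orbit-finite nominal sets by strong ones -/

section Cover

/-- The alphabet with one orbit of `k`-tuples of distinct names for each index. -/
@[ext]
structure TupleAlphabet (𝔸 I : Type u) (k : ℕ) : Type u where
  index : I
  tuple : Fin k ↪ 𝔸

namespace TupleAlphabet

variable {𝔸 I : Type u} {k : ℕ}

instance : MulAction (FinPerm 𝔸) (TupleAlphabet 𝔸 I k) where
  smul π x := ⟨x.index, x.tuple.trans (MulAction.toPerm π).toEmbedding⟩
  one_smul _ := rfl
  mul_smul _ _ _ := rfl

theorem smul_eq_iff (π : FinPerm 𝔸) (x y : TupleAlphabet 𝔸 I k) :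
    π • x = y ↔ x.index = y.index ∧ ∀ j, π • x.tuple j = y.tuple j := by
  rw [TupleAlphabet.ext_iff, DFunLike.ext_iff (F := Fin k ↪ 𝔸)]
  rfl

theorem smul_eq_self_iff (π : FinPerm 𝔸) (x : TupleAlphabet 𝔸 I k) :
    π • x = x ↔ ∀ a ∈ Set.range x.tuple, π • a = a := by
  rw [smul_eq_iff, Set.forall_mem_range]
  exact and_iff_right rfl

theorem supports_range (x : TupleAlphabet 𝔸 I k) :
    Supports (FinPerm 𝔸) (Set.range x.tuple) x :=
  fun π hπ => (smul_eq_self_iff π x).2 fun _ ha => hπ ha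

instance : Nominal 𝔸 (TupleAlphabet 𝔸 I k) where
  finSupp x := ⟨Set.range x.tuple, Set.finite_range _, supports_range x⟩

/-- A permutation fixing a letter fixes each entry of its tuple, and the support lies among these
entries. The other implication holds in any nominal set. -/
theorem isStrong [Infinite 𝔸] : IsStrong 𝔸 (TupleAlphabet 𝔸 I k) := fun x π =>
  ⟨fun h a ha => (smul_eq_self_iff π x).1 h a
    (supp_subset (Set.finite_range _) (supports_range x) ha),
    fun h => supports_supp x π fun _ ha => h _ ha⟩

theorem exists_smul_eq (f g : Fin k ↪ 𝔸) : ∃ π : FinPerm 𝔸, ∀ j, π • f j = g j := by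
  obtain ⟨π, hπ, -⟩ := exists_extension (Set.range f) (Set.finite_range f)
    -- On the range of `f` this is `f j ↦ g j`, which is injective because `g` is; the default `id`
    -- is never evaluated there.
    (Function.extend f g id) (by
      rintro _ ⟨i, rfl⟩ _ ⟨j, rfl⟩ h
      rw [f.injective.extend_apply, f.injective.extend_apply] at h
      rw [g.injective h])
  exact ⟨π, fun j => by rw [hπ _ ⟨j, rfl⟩, f.injective.extend_apply]⟩

instance [Infinite 𝔸] [Finite I] : OrbitFinite 𝔸 (TupleAlphabet 𝔸 I k) := by
  obtain ⟨f₀⟩ : Nonempty (Fin k ↪ 𝔸) :=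
    ⟨Fin.valEmbedding.trans (Infinite.natEmbedding 𝔸)⟩
  refine ⟨Finite.of_surjective (fun i : I => Quotient.mk'' (⟨i, f₀⟩ : TupleAlphabet 𝔸 I k)) ?_⟩
  intro q
  induction q using Quotient.inductionOn' with
  | h x =>
    obtain ⟨π, hπ⟩ := exists_smul_eq x.tuple f₀
    exact ⟨x.index, Quotient.sound' ⟨π, (smul_eq_iff _ _ _).2 ⟨rfl, hπ⟩⟩⟩

end TupleAlphabet

variable {𝔸 : Type u} [Infinite 𝔸]

/-- The supports in an orbit-finite nominal set are of bounded size. -/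
theorem exists_supp_encard_le (X : Type u) [MulAction (FinPerm 𝔸) X] [Nominal 𝔸 X]
    [OrbitFinite 𝔸 X] : ∃ k : ℕ, ∀ x : X, (supp 𝔸 x).encard ≤ k := by
  have : Finite (MulAction.orbitRel.Quotient (FinPerm 𝔸) X) := OrbitFinite.finite
  obtain ⟨k, hk⟩ := (Set.finite_range fun q : MulAction.orbitRel.Quotient (FinPerm 𝔸) X =>
    (supp 𝔸 q.out).ncard).bddAbove
  refine ⟨k, fun x => ?_⟩
  obtain ⟨π, hπ⟩ : x ∈ MulAction.orbit (FinPerm 𝔸)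
      (Quotient.mk'' x : MulAction.orbitRel.Quotient (FinPerm 𝔸) X).out :=
    (MulAction.orbitRel (FinPerm 𝔸) X).symm
      (Quotient.mk_out (s := MulAction.orbitRel (FinPerm 𝔸) X) x)
  have h1 := supp_smul_subset π (Quotient.mk'' x : MulAction.orbitRel.Quotient (FinPerm 𝔸) X).out
  rw [show π • _ = x from hπ] at h1
  refine (Set.encard_le_encard h1).trans ((Set.encard_image_le _ _).trans ?_)
  rw [← (supp_finite _).cast_ncard_eq]
  exact_mod_cast hk ⟨_, rfl⟩

/-- Every orbit-finite nominal set is a quotient of a strong one. -/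
theorem exists_strong_cover (X : Type u) [MulAction (FinPerm 𝔸) X] [Nominal 𝔸 X]
    [OrbitFinite 𝔸 X] : ∃ (I : Type u) (_ : Finite I) (k : ℕ)
      (p : TupleAlphabet 𝔸 I k →[FinPerm 𝔸] X), Function.Surjective p := by
  obtain ⟨k, hk⟩ := exists_supp_encard_le (𝔸 := 𝔸) X
  obtain ⟨T, hT⟩ := Infinite.exists_subset_card_eq 𝔸 k
  let f₀ : Fin k ↪ 𝔸 :=
    (T.equivFinOfCardEq hT).symm.toEmbedding.trans (Function.Embedding.subtype _)
  have hf₀ : ∀ a ∈ T, ∃ j, f₀ j = a := fun a ha => ⟨T.equivFinOfCardEq hT ⟨a, ha⟩, by simp [f₀]⟩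
  -- One index for each element supported by the fixed `k`-set `T`. Since `k` bounds all supports,
  -- every orbit of `X` meets `I`.
  let I : Type u := {x : X | Supports (FinPerm 𝔸) (T : Set 𝔸) x}
  have hI : Finite I := finite_supports (T : Set 𝔸) T.finite_toSet
  have hfix : ∀ (i : I) (π : FinPerm 𝔸), (∀ j, π • f₀ j = f₀ j) → π • i.1 = i.1 := fun i π h =>
    supports_fix i.2 fun a ha => by
      obtain ⟨j, rfl⟩ := hf₀ a ha
      exact h j
  -- The letter with index `i` and tuple `π • f₀` is to be sent to `π • i`. The choice of `π` is
  -- immaterial because `f₀` enumerates `T`, which supports `i`.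
  obtain ⟨p, hp⟩ := exists_equivariant_choice (G := FinPerm 𝔸)
    (fun (a : TupleAlphabet 𝔸 I k) (x : X) =>
      ∃ π : FinPerm 𝔸, (∀ j, π • f₀ j = a.tuple j) ∧ π • a.index.1 = x)
    (by
      rintro σ a _ ⟨π, hπ, rfl⟩
      exact ⟨σ * π, fun j => by rw [mul_smul, hπ]; rfl, mul_smul _ _ _⟩)
    (by
      intro a
      obtain ⟨π, hπ⟩ := TupleAlphabet.exists_smul_eq f₀ a.tuple
      refine ⟨π • a.index.1, ⟨π, hπ, rfl⟩, fun σ hσ => ?_⟩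
      have hσ := ((TupleAlphabet.smul_eq_iff _ _ _).1 hσ).2
      have := hfix a.index (π⁻¹ * (σ * π)) fun j => by
        rw [mul_smul, inv_smul_eq_iff, mul_smul, hπ, hσ]
      rwa [mul_smul, inv_smul_eq_iff, mul_smul] at this)
  refine ⟨I, hI, k, p, fun x => ?_⟩
  obtain ⟨π, hπ⟩ := exists_smul_supports x (T : Set 𝔸) T.finite_toSet (by
    have := hk x
    rw [← (supp_finite x).cast_ncard_eq] at this
    rw [Set.ncard_coe_finset, hT]
    exact_mod_cast this)
  -- Here `σ` fixes `f₀`, so it fixes `π • x`. The letter thus maps to `π • x`, and translating it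
  -- by `π⁻¹` gives a preimage of `x`.
  obtain ⟨σ, hσ, h⟩ := hp ⟨⟨π • x, hπ⟩, f₀⟩
  refine ⟨π⁻¹ • ⟨⟨π • x, hπ⟩, f₀⟩, ?_⟩
  rw [map_smul, ← h, inv_smul_eq_iff]
  exact hfix ⟨π • x, hπ⟩ σ hσ

end Cover

/-! ### Support reflection versus projectivity -/

section Main

variable {𝔸 : Type u} [Infinite 𝔸] {M N : Type u}
  [Monoid M] [MulDistribMulAction (FinPerm 𝔸) M] [Nominal 𝔸 M]
  [Monoid N] [MulDistribMulAction (FinPerm 𝔸) N] {e : M →*[FinPerm 𝔸] N}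

/-- Morphisms on words over a strong alphabet lift along support-reflecting morphisms without
enlarging supports. -/
theorem IsMSR.exists_lift (he : IsMSR e) {Γ : Type u} [MulAction (FinPerm 𝔸) Γ] [Nominal 𝔸 Γ]
    (hΓ : IsStrong 𝔸 Γ) (h : FreeMonoid Γ →*[FinPerm 𝔸] N) :
    ∃ h' : FreeMonoid Γ →*[FinPerm 𝔸] M, ∀ w, e (h' w) = h w ∧ supp 𝔸 (h' w) = supp 𝔸 (h w) := by
  obtain ⟨M', hM', hsurj, hsupp⟩ := he
  obtain ⟨φ, hφ⟩ := exists_equivariant_choice (G := FinPerm 𝔸)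
    (fun (a : Γ) (x : M) => x ∈ M' ∧ e x = h (FreeMonoid.of a))
    (fun π a x hx => ⟨hM' π x hx.1, by
      rw [map_smul, hx.2, ← map_smul]
      rfl⟩)
    (fun a => by
      obtain ⟨x, hx, hxa⟩ := hsurj (h (FreeMonoid.of a))
      -- If `π` fixes the letter `a`, it fixes the names in `supp a` by strongness. It then fixes
      -- those in `supp x = supp (h a) ⊆ supp a`, hence `x`.
      refine ⟨x, ⟨hx, hxa⟩, fun π hπ => supports_fix (supports_supp x) fun b hb => ?_⟩
      have hb' : b ∈ supp 𝔸 (h (FreeMonoid.of a)) := by rwa [← hxa, hsupp x hx]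
      refine (hΓ a π).1 hπ b (supp_subset (supp_finite a) (fun σ hσ => ?_) hb')
      rw [← map_smul]
      exact congrArg (fun c => h (FreeMonoid.of c)) (supports_supp a σ hσ))
  have key : ∀ w, freeLift φ w ∈ M' ∧ e (freeLift φ w) = h w := by
    intro w
    induction w using FreeMonoid.inductionOn' with
    | one => simp only [map_one, one_mem, and_self]
    | of_mul a w ih =>
      rw [map_mul, map_mul, map_mul, freeLift_of, (hφ a).2, ih.2]
      exact ⟨mul_mem (hφ a).1 ih.1, rfl⟩
  refine ⟨freeLift φ, fun w => ⟨(key w).2, ?_⟩⟩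
  rw [← (key w).2, hsupp _ (key w).1]

variable [OrbitFinite 𝔸 M] [Nominal 𝔸 N] [OrbitFinite 𝔸 N]

/-- The lift on finite words keeps the supports of the values of `f`, so it inherits `s`-boundedness
and extends continuously. Density of finite words turns agreement with `f` there into equality. -/
theorem IsMSR.projectiveWrt (he : IsMSR e) {Γ : Type u} [MulAction (FinPerm 𝔸) Γ] [Nominal 𝔸 Γ]
    (hΓ : IsStrong 𝔸 Γ) (s : SupportBound 𝔸 Γ) :
    ProjectiveWrt (NStoneMon.proWords s) (NStoneMon.homOfDiscrete e) := by
  rintro ⟨f, hf⟩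
  let f' : ProWord s →*[FinPerm 𝔸] N := f
  obtain ⟨h, hh⟩ := he.exists_lift hΓ (f'.comp (ProWord.ofWord s))
  obtain ⟨g, hg, hgh⟩ := ProWord.exists_hom_extension (s := s) h fun w => by
    rw [(hh w).2]
    exact (supp_map_subset f'.toMulActionHom (ProWord.ofWord s w)).trans
      (ProWord.supp_ofWord_subset w)
  refine ⟨NStoneMon.Hom.mk (X := NStoneMon.proWords s) (Y := NStoneMon.ofDiscrete 𝔸 M) g hg,
    NStoneMon.Hom.ext (DFunLike.coe_injective ?_)⟩
  refine ProWord.eq_of_eq_ofWord (s := s) (X := N) (f := e.comp g) (g := f')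
    (fun U hU => hg _ (FinSupp.preimage e.toMulActionHom hU)) hf fun w => ?_
  exact (congrArg e (hgh w)).trans (hh w).1

/-- The supports of the values of a morphism on words, as a support bound. -/
def SupportBound.ofHom {Γ : Type u} [MulAction (FinPerm 𝔸) Γ]
    (h : FreeMonoid Γ →*[FinPerm 𝔸] N) : SupportBound 𝔸 Γ where
  toFun w := supp 𝔸 (h w)
  bounded := by
    obtain ⟨k, hk⟩ := exists_supp_encard_le (𝔸 := 𝔸) N
    exact ⟨k, fun w => hk (h w)⟩

/-- With the bound `s w = supp (h w)`, projectivity itself yields lifts of the values `h w` that use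
no further names. They are closed under multiplication because the lift is a morphism. -/
theorem isMSR_of_projectiveWrt {Γ : Type u} [MulAction (FinPerm 𝔸) Γ] [Nominal 𝔸 Γ]
    (h : FreeMonoid Γ →*[FinPerm 𝔸] N) (hh : Function.Surjective h)
    (hp : ProjectiveWrt (NStoneMon.proWords (SupportBound.ofHom h))
      (NStoneMon.homOfDiscrete e)) : IsMSR e := by
  obtain ⟨f, hf, hfh⟩ := ProWord.exists_hom_extension (s := SupportBound.ofHom h) h
    fun _ => subset_rfl
  obtain ⟨⟨g, hg⟩, hgf⟩ := hp (NStoneMon.Hom.mk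
    (X := NStoneMon.proWords (SupportBound.ofHom h)) (Y := NStoneMon.ofDiscrete 𝔸 N) f hf)
  let g' : ProWord (SupportBound.ofHom h) →*[FinPerm 𝔸] M := g
  have hgf' : ∀ x, e (g' x) = f x := fun x =>
    DFunLike.congr_fun (congrArg NStoneMon.Hom.toHom hgf) x
  let l : FreeMonoid Γ →*[FinPerm 𝔸] M := g'.comp (ProWord.ofWord _)
  have hl : ∀ w, e (l w) = h w := fun w => (hgf' _).trans (hfh w)
  refine ⟨MonoidHom.mrange (l : FreeMonoid Γ →* M), ?_, fun y => ?_, ?_⟩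
  · rintro π _ ⟨w, rfl⟩
    exact ⟨π • w, map_smul l π w⟩
  · obtain ⟨w, rfl⟩ := hh y
    exact ⟨l w, ⟨w, rfl⟩, hl w⟩
  · rintro _ ⟨w, rfl⟩
    change supp 𝔸 (e (l w)) = supp 𝔸 (l w)
    refine (supp_map_subset e.toMulActionHom (l w)).antisymm ?_
    change supp 𝔸 (l w) ⊆ supp 𝔸 (e (l w))
    rw [hl]
    -- The names of `l w` are among those of `w` viewed in the limit, hence among those of `h w` by
    -- the choice of the bound.
    exact (supp_map_subset g'.toMulActionHom _).trans
      (ProWord.supp_ofWord_subset (s := SupportBound.ofHom h) w)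

end Main

end NomMon

theorem mainTheorem7 {𝔸 : Type u} [Countable 𝔸] [Infinite 𝔸] {M N : Type u}
    [Monoid M] [MulDistribMulAction (NomMon.FinPerm 𝔸) M] [NomMon.Nominal 𝔸 M]
    [NomMon.OrbitFinite 𝔸 M]
    [Monoid N] [MulDistribMulAction (NomMon.FinPerm 𝔸) N] [NomMon.Nominal 𝔸 N]
    [NomMon.OrbitFinite 𝔸 N]
    (e : M →*[NomMon.FinPerm 𝔸] N) (he : Function.Surjective e) :
    NomMon.IsMSR e ↔
      ∀ (Γ : Type u) [MulAction (NomMon.FinPerm 𝔸) Γ] [NomMon.Nominal 𝔸 Γ]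
        [NomMon.OrbitFinite 𝔸 Γ], NomMon.IsStrong 𝔸 Γ →
        ∀ s : NomMon.SupportBound 𝔸 Γ,
          NomMon.ProjectiveWrt (NomMon.NStoneMon.proWords s)
            (NomMon.NStoneMon.homOfDiscrete e) := by
  refine ⟨fun h Γ _ _ _ hΓ s => h.projectiveWrt hΓ s, fun h => ?_⟩
  -- A single test alphabet suffices for the converse: a strong cover of `N`, whose letters already
  -- hit every element.
  obtain ⟨I, _, k, p, hp⟩ := NomMon.exists_strong_cover (𝔸 := 𝔸) N
  refine NomMon.isMSR_of_projectiveWrt (NomMon.freeLift p) (fun y => ?_)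
    (h _ NomMon.TupleAlphabet.isStrong _)
  obtain ⟨a, rfl⟩ := hp y
  exact ⟨FreeMonoid.of a, NomMon.freeLift_of p a⟩
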